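/- Let $\mathbb{H}$ be the upper half-plane and let $G=\{(M_1,M_2)\in \mathrm{SL}_2(\mathbb{Z})\times \mathrm{SL}_2(\mathbb{Z}) : M_1\equiv M_2 \pmod 2\}$. For $k\in\mathbb{Z}$, a modular form of weight $k$ for $G$ is a holomorphic function $f:\mathbb{H}\times\mathbb{H}\to\mathbb{C}$ such that $$f(M_1\tau_1,M_2\tau_2)=(c_1\tau_1+d_1)^k(c_2\tau_2+d_2)^k f(\tau_1,\tau_2)\quad\text{for all } \left(\begin{pmatrix} a_1&b_1\\c_1&d_1\end{pmatrix},\begin{pmatrix} a_2&b_2\\c_2&d_2\end{pmatrix}\right)=(M_1,M_2)\in G,$$ and such that the limits $\Phi_1 f(\tau)=\lim_{z\to i\infty}f(z,\tau)$ and $\Phi_2 f(\tau)=\lim_{z\to i\infty}f(\tau,z)$ exist for all $\tau \in \mathbb{H}$ and define holomorphic modular forms of weight $k$ for $\Gamma_0(2)$; $f$ is a cusp form if moreover $\Phi_1f=\Phi_2f=0$, and $f$ is symmetric if $f(\tau_1,\tau_2)=f(\tau_2,\tau_1)$. Let $M_k^{sym}(G)$ be the space of symmetric modular forms of weight $k$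 and let $M_*^{sym}(G)=\bigoplus_{k\in\mathbb{Z}}M_k^{sym}(G)$, a graded ring under multiplication of functions. Let $E_2(\tau)=1-24\sum_{n\ge1}\sigma_1(n)q^n$ with $q=e^{2\pi i\tau}$, $e_1(\tau)=2E_2(2\tau)-E_2(\tau)$, $e_2(\tau)=E_2(\tau)-\tfrac12E_2(\tau/2)$, $f_{ij}(\tau_1,\tau_2)=e_i(\tau_1)e_j(\tau_2)$ for $i,j\in\{1,2\}$, and let $\eta(\tau)=q^{1/24}\prod_{n\ge1}(1-q^n)$, where $q^{1/24}=e^{2\pi i\tau/24}$. Put $$X_2=\tfrac43(f_{11}+f_{22})-\tfrac23(f_{12}+f_{21}),\qquad X_4=\tfrac1{144}(f_{12}-f_{21})^2,\qquad \Delta_6(\tau_1,\tau_2)=\eta(\tau_1)^{12}\eta(\tau_2)^{12}.$$ Then $X_2,X_4,\Delta_6$ are symmetric modular forms for $G$ of weights $2,4,6$ respectively, $\Delta_6$ is a cusp form, $$\Delta_6=\tfrac1{2916}(f_{11}+f_{12}+f_{21}+f_{22})(f_{11}-2f_{12}-2f_{21}+4f_{22})(4f_{11}-2f_{12}-2f_{21}+f_{22}),$$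 and $M_*^{sym}(G)=\mathbb{C}[X_2,X_4,\Delta_6]$ is a polynomial ring in three variables, i.e. the $\mathbb{C}$-algebra homomorphism $\mathbb{C}[x,y,z]\to M_*^{sym}(G)$ with $x\mapsto X_2$, $y\mapsto X_4$, $z\mapsto\Delta_6$ is an isomorphism. -/

import Mathlib

open Filter Topology UpperHalfPlane MatrixGroups

noncomputable section

namespace DegenerateHilbert

/-- The group of pairs `(M₁, M₂)` in `SL₂(ℤ) × SL₂(ℤ)` with `M₁ ≡ M₂ (mod 2)`. -/
def G : Subgroup (SL(2, ℤ) × SL(2, ℤ)) where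
  carrier := {M | Matrix.SpecialLinearGroup.map (Int.castRingHom (ZMod 2)) M.1 =
    Matrix.SpecialLinearGroup.map (Int.castRingHom (ZMod 2)) M.2}
  mul_mem' {a b} ha hb := by
    simp only [Set.mem_ofPred_eq, Prod.fst_mul, Prod.snd_mul, map_mul] at *
    rw [ha, hb]
  one_mem' := by simp
  inv_mem' {a} ha := by
    simp only [Set.mem_ofPred_eq, Prod.fst_inv, Prod.snd_inv, map_inv] at *
    rw [ha]

/-- Holomorphic functions on `ℍ × ℍ`, viewed as an open subset of `ℂ × ℂ`. -/
def IsHolomorphic (f : ℍ × ℍ → ℂ) : Prop :=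
  DifferentiableOn ℂ (fun z : ℂ × ℂ => f (ofComplex z.1, ofComplex z.2))
    {z : ℂ × ℂ | 0 < z.1.im ∧ 0 < z.2.im}

/-- `IsPhi₁ f g` says that `Φ₁ f` exists and equals `g`: for every `τ`,
`lim_{z → i∞} f(z, τ) = g(τ)`. -/
def IsPhi₁ (f : ℍ × ℍ → ℂ) (g : ℍ → ℂ) : Prop :=
  ∀ τ : ℍ, Tendsto (fun z : ℍ => f (z, τ)) atImInfty (𝓝 (g τ))

/-- `IsPhi₂ f g` says that `Φ₂ f` exists and equals `g`: for every `τ`,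
`lim_{z → i∞} f(τ, z) = g(τ)`. -/
def IsPhi₂ (f : ℍ × ℍ → ℂ) (g : ℍ → ℂ) : Prop :=
  ∀ τ : ℍ, Tendsto (fun z : ℍ => f (τ, z)) atImInfty (𝓝 (g τ))

/-- Modular forms of weight `k` and level `Γ₀(2)`. -/
abbrev LevelTwoForm (k : ℤ) : Type :=
  ModularForm ((CongruenceSubgroup.Gamma0 2).map (Matrix.SpecialLinearGroup.mapGL ℝ)) k

/-- Modular forms of weight `k` for `G`. -/
structure IsModularForm (k : ℤ) (f : ℍ × ℍ → ℂ) : Prop where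
  holo : IsHolomorphic f
  transform : ∀ M ∈ G, ∀ τ₁ τ₂ : ℍ, f (M.1 • τ₁, M.2 • τ₂) =
    ((M.1 1 0 : ℂ) * τ₁ + (M.1 1 1 : ℂ)) ^ k * ((M.2 1 0 : ℂ) * τ₂ + (M.2 1 1 : ℂ)) ^ k *
      f (τ₁, τ₂)
  phi₁ : ∃ g : LevelTwoForm k, IsPhi₁ f g
  phi₂ : ∃ g : LevelTwoForm k, IsPhi₂ f g

/-- Cusp forms of weight `k` for `G`. -/
structure IsCuspForm (k : ℤ) (f : ℍ × ℍ → ℂ) : Prop where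
  modular : IsModularForm k f
  phi₁_zero : IsPhi₁ f 0
  phi₂_zero : IsPhi₂ f 0

/-- The space `M_k(G)`. -/
def modularForms (k : ℤ) : Submodule ℂ (ℍ × ℍ → ℂ) where
  carrier := {f | IsModularForm k f}
  zero_mem' :=
    { holo := differentiableOn_const 0
      transform := fun M _ τ₁ τ₂ => by simp
      phi₁ := ⟨0, fun τ => by simp⟩
      phi₂ := ⟨0, fun τ => by simp⟩ }
  add_mem' {f g} hf hg :=
    { holo := DifferentiableOn.add hf.holo hg.holo
      transform := fun M hM τ₁ τ₂ => by
        simp only [Pi.add_apply, hf.transform M hM, hg.transform M hM]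
        ring
      phi₁ := by
        obtain ⟨u, hu⟩ := hf.phi₁
        obtain ⟨v, hv⟩ := hg.phi₁
        exact ⟨u + v, fun τ => (hu τ).add (hv τ)⟩
      phi₂ := by
        obtain ⟨u, hu⟩ := hf.phi₂
        obtain ⟨v, hv⟩ := hg.phi₂
        exact ⟨u + v, fun τ => (hu τ).add (hv τ)⟩ }
  smul_mem' c f hf :=
    { holo := DifferentiableOn.const_smul hf.holo c
      transform := fun M hM τ₁ τ₂ => by
        simp only [Pi.smul_apply, smul_eq_mul, hf.transform M hM]
        ring
      phi₁ := by
        obtain ⟨u, hu⟩ := hf.phi₁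
        exact ⟨c • u, fun τ => (hu τ).const_smul c⟩
      phi₂ := by
        obtain ⟨u, hu⟩ := hf.phi₂
        exact ⟨c • u, fun τ => (hu τ).const_smul c⟩ }

/-- The functions with `f(τ₁, τ₂) = f(τ₂, τ₁)`. -/
def symmetricFunctions : Submodule ℂ (ℍ × ℍ → ℂ) where
  carrier := {f | ∀ τ₁ τ₂ : ℍ, f (τ₁, τ₂) = f (τ₂, τ₁)}
  zero_mem' := fun _ _ => rfl
  add_mem' {f g} hf hg τ₁ τ₂ := by
    simp only [Pi.add_apply, hf τ₁ τ₂, hg τ₁ τ₂]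
  smul_mem' c f hf τ₁ τ₂ := by
    simp only [Pi.smul_apply, hf τ₁ τ₂]

/-- The space of symmetric modular forms of weight `k` for `G`. -/
def symForms (k : ℤ) : Submodule ℂ (ℍ × ℍ → ℂ) :=
  modularForms k ⊓ symmetricFunctions

theorem one_mem_modularForms : (1 : ℍ × ℍ → ℂ) ∈ modularForms 0 where
  holo := differentiableOn_const 1
  transform := fun M _ τ₁ τ₂ => by simp
  phi₁ := ⟨1, fun τ => by simp⟩
  phi₂ := ⟨1, fun τ => by simp⟩

theorem factor_ne_zero (M : SL(2, ℤ)) (τ : ℍ) :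
    (M 1 0 : ℂ) * τ + (M 1 1 : ℂ) ≠ 0 := by
  have h := denom_ne_zero (M : GL (Fin 2) ℝ) τ
  rwa [ModularGroup.denom_apply] at h

theorem mul_mem_modularForms {k l : ℤ} {f g : ℍ × ℍ → ℂ}
    (hf : f ∈ modularForms k) (hg : g ∈ modularForms l) : f * g ∈ modularForms (k + l) where
  holo := DifferentiableOn.mul hf.holo hg.holo
  transform := fun M hM τ₁ τ₂ => by
    simp only [Pi.mul_apply, hf.transform M hM, hg.transform M hM]
    rw [zpow_add₀ (factor_ne_zero M.1 τ₁), zpow_add₀ (factor_ne_zero M.2 τ₂)]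
    ring
  phi₁ := by
    obtain ⟨u, hu⟩ := hf.phi₁
    obtain ⟨v, hv⟩ := hg.phi₁
    exact ⟨u.mul v, fun τ => (hu τ).mul (hv τ)⟩
  phi₂ := by
    obtain ⟨u, hu⟩ := hf.phi₂
    obtain ⟨v, hv⟩ := hg.phi₂
    exact ⟨u.mul v, fun τ => (hu τ).mul (hv τ)⟩

instance symFormsGradedMonoid : SetLike.GradedMonoid symForms where
  one_mem := ⟨one_mem_modularForms, fun _ _ => rfl⟩
  mul_mem _ _ f g hf hg := ⟨mul_mem_modularForms hf.1 hg.1, fun τ₁ τ₂ => by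
    simp only [Pi.mul_apply, hf.2 τ₁ τ₂, hg.2 τ₁ τ₂]⟩

/-- The graded ring `M_*^sym(G) = ⨁ₖ M_k^sym(G)`; multiplication is that of functions. -/
abbrev SymRing : Type := DirectSum ℤ (fun k : ℤ => symForms k)

/-- `e₁(τ) = 2 E₂(2τ) - E₂(τ)`. -/
def e₁ (τ : ℍ) : ℂ :=
  2 * EisensteinSeries.E2 (ofComplex (2 * τ)) - EisensteinSeries.E2 τ

/-- `e₂(τ) = E₂(τ) - E₂(τ/2)/2`. -/
def e₂ (τ : ℍ) : ℂ :=
  EisensteinSeries.E2 τ - 1 / 2 * EisensteinSeries.E2 (ofComplex (τ / 2))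

def f₁₁ : ℍ × ℍ → ℂ := fun τ => e₁ τ.1 * e₁ τ.2
def f₁₂ : ℍ × ℍ → ℂ := fun τ => e₁ τ.1 * e₂ τ.2
def f₂₁ : ℍ × ℍ → ℂ := fun τ => e₂ τ.1 * e₁ τ.2
def f₂₂ : ℍ × ℍ → ℂ := fun τ => e₂ τ.1 * e₂ τ.2

def X₂ : ℍ × ℍ → ℂ := fun τ =>
  4 / 3 * (f₁₁ τ + f₂₂ τ) - 2 / 3 * (f₁₂ τ + f₂₁ τ)

def X₄ : ℍ × ℍ → ℂ := fun τ => 1 / 144 * (f₁₂ τ - f₂₁ τ) ^ 2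

def Δ₆ : ℍ × ℍ → ℂ := fun τ => ModularForm.eta τ.1 ^ 12 * ModularForm.eta τ.2 ^ 12

end DegenerateHilbert

end

open DegenerateHilbert

/-!
Write `M_*(Γ)` for the ring of modular forms of a group `Γ`. Up to sign, `SL₂(ℤ)` permutes the three
forms `e₁ + e₂`, `e₁ - 2 e₂`, `2 e₁ - e₂` of weight two through its quotient `SL₂(𝔽₂) ≅ S₃`
(`divisionValue_slash`): they are the pairwise differences of the division values `e₁`, `-e₂`,
`e₂ - e₁`, which are permuted without signs. Their product is `-54 η¹²` (`division_product_eq`),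
because the quotient is a form of weight zero and level one. So none of the three vanishes on the
upper half-plane, and multiplying the formula at `τ₁` by the formula at `τ₂` gives the
factorization of `Δ₆` (`Δ₆_eq`).

In one variable, `M_*(Γ(2)) = ℂ[e₁, e₂]` (`PrincipalForm.exists_eq_sum`). The only zero of
`e₁ - 2 e₂` is a simple one at the cusp `i∞`, so a form that vanishes at `i∞` is divisible by it
(`exists_eq_e₁_sub_two_mul_e₂_mul`), and one descends to weight zero, where forms are constant.

For two variables, fix `τ₂`: a form for `G` is then a form for `Γ(2)` in `τ₁`, since its
translates by `γ` are again slices of it, with limits at `i∞`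
(`IsModularForm.exists_slice`). A symmetric form of weight `2 m` therefore lies in the tensor square
of the finite-dimensional space of forms of weight `2 m` for `Γ(2)` (`exists_eq_double_sum`),
and forms of odd or negative weight are zero. Symmetry under the exchange of the variables makes it
a homogeneous polynomial of degree `m` in the three products `L₁, L₂, L₃`, where `Lᵢ` is the value
at `τ₁` times the value at `τ₂` of one of the three forms above
(`exists_isHomogeneous_eval_lineProducts`). The diagonal of `SL₂(ℤ)` permutes the `Lᵢ`, now without
signs. Since the `Lᵢ` are algebraically independent (`eq_zero_of_forall_eval_lineProducts`), the
polynomial is symmetric, and the fundamental theorem on symmetric polynomials identifies the ring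
with the polynomial ring on the elementary symmetric functions `s₁, s₂, s₃` of the `Lᵢ`. Finally
`X₂ = 2 s₁ / 9`, `X₄ = (s₁² - 4 s₂) / 1296`, `Δ₆ = s₃ / 2916` (`generators_eq_eval_esymm`).

That the elements of the graded ring may be treated as functions is
`coeAlgHom_symForms_injective`.
-/

noncomputable section

namespace DegenerateHilbert

open EisensteinSeries Manifold ModularForm CongruenceSubgroup

/-! ### The Eisenstein series `E₂` along affine maps -/

/-- The quasi-modularity of `E₂`; the constant `6 i / π` is left in terms of `ζ(2)` because only
its cancellation matters. -/
theorem E2_smul (γ : SL(2, ℤ)) (τ : ℍ) :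
    E2 (γ • τ) = ((γ 1 0 : ℂ) * τ + (γ 1 1 : ℂ)) ^ 2 * E2 τ -
      1 / (2 * riemannZeta 2) * (2 * Real.pi * Complex.I) * (γ 1 0 : ℂ) *
        ((γ 1 0 : ℂ) * τ + (γ 1 1 : ℂ)) := by
  have h := congrFun (E2_slash_action γ) τ
  have hd := factor_ne_zero γ τ
  simp only [SL_slash_apply, ModularGroup.denom_apply, Pi.sub_apply, Pi.smul_apply, smul_eq_mul,
    D2, zpow_neg] at h
  rw [← div_eq_mul_inv, div_eq_iff (zpow_ne_zero _ hd)] at h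
  rw [h, zpow_ofNat]
  field_simp

theorem E2_ofComplex_add_one {w : ℂ} (hw : 0 < w.im) :
    E2 (ofComplex (w + 1)) = E2 (ofComplex w) := by
  have h := E2_smul ModularGroup.T ⟨w, hw⟩
  have e : ModularGroup.T • (⟨w, hw⟩ : ℍ) = ofComplex (w + 1) := by
    rw [ofComplex_apply_of_im_pos (by simpa using hw), modular_T_smul]
    apply UpperHalfPlane.ext
    simp [add_comm]
  rw [e] at h
  rw [h, ofComplex_apply_of_im_pos hw]
  simp [ModularGroup.T]

theorem E2_ofComplex_neg_one_div {w : ℂ} (hw : 0 < w.im) :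
    E2 (ofComplex (-1 / w)) =
      w ^ 2 * E2 (ofComplex w) - 1 / (2 * riemannZeta 2) * (2 * Real.pi * Complex.I) * w := by
  have h := E2_smul ModularGroup.S ⟨w, hw⟩
  have e : ofComplex (-1 / w) = ModularGroup.S • (⟨w, hw⟩ : ℍ) := by
    rw [← ofComplex_apply (ModularGroup.S • (⟨w, hw⟩ : ℍ)), modular_S_smul]
    congr 1
    simp [neg_div, inv_neg]
  rw [e, h, ofComplex_apply_of_im_pos hw]
  simp [ModularGroup.S]

theorem mdifferentiable_comp_affine {f : ℍ → ℂ} (hf : MDiff f) {a : ℝ} (ha : 0 < a) (b : ℝ) :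
    MDiff fun τ : ℍ => f (ofComplex (a * τ + b)) := by
  rw [mdifferentiable_iff] at hf ⊢
  have h : DifferentiableOn ℂ ((f ∘ ofComplex) ∘ fun z : ℂ => a * z + b) {z | 0 < z.im} :=
    hf.comp (by fun_prop) fun z hz => by simpa using mul_pos ha hz
  exact h.congr fun z hz => by simp [ofComplex_apply_of_im_pos hz]

theorem tendsto_affine_atImInfty {a : ℝ} (ha : 0 < a) (b : ℝ) :
    Tendsto (fun τ : ℍ => ofComplex (a * τ + b)) atImInfty atImInfty := by
  refine tendsto_comap_iff.mpr ?_
  have h : (UpperHalfPlane.im ∘ fun τ : ℍ => ofComplex (a * τ + b)) = fun τ : ℍ => a * τ.im := by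
    ext τ
    have : 0 < ((a : ℂ) * τ + b).im := by simpa using mul_pos ha τ.im_pos
    rw [Function.comp_apply, ofComplex_apply_of_im_pos this]
    simp
  rw [h]
  exact tendsto_comap.const_mul_atTop ha

theorem tendsto_qParam_one_atImInfty :
    Tendsto (fun τ : ℍ => Function.Periodic.qParam 1 τ) atImInfty (𝓝[≠] 0) :=
  tendsto_nhdsWithin_iff.mpr ⟨qParam_tendsto_atImInfty one_pos,
    Eventually.of_forall fun _ => Complex.exp_ne_zero _⟩

theorem tendsto_E2_sub_one_div :
    Tendsto (fun τ : ℍ => (E2 τ - 1) / Function.Periodic.qParam 1 τ) atImInfty (𝓝 (-24)) := by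
  have hper : Function.Periodic (E2 ∘ ofComplex) (1 : ℝ) := by
    intro w
    by_cases hw : 0 < w.im
    · simpa using E2_ofComplex_add_one hw
    · have hw' : (w + (1 : ℝ)).im ≤ 0 := by simpa using hw
      simp only [Function.comp_apply]
      rw [ofComplex_apply_of_im_nonpos hw', ofComplex_apply_of_im_nonpos (not_lt.mp hw)]
  have hsum (τ : ℍ) : HasSum (fun m : ℕ =>
      (if m = 0 then 1 else -24 * ArithmeticFunction.sigma 1 m : ℂ) •
        Function.Periodic.qParam 1 τ ^ m) (E2 τ) := by
    simpa only [Function.Periodic.qParam, Complex.ofReal_one, div_one] using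
      hasSum_qExpansion_E2 (z := τ)
  have han := analyticAt_cuspFunction_zero one_pos hper E2_mdifferentiable isBoundedAtImInfty_E2
  have hF := (hasFPowerSeriesOnBall_cuspFunction one_pos han hsum).hasFPowerSeriesAt
  have h0 : cuspFunction 1 E2 0 = 1 := by
    simpa using (hF.coeff_zero ![]).symm
  have hd := hF.hasDerivAt.tendsto_slope_zero.comp tendsto_qParam_one_atImInfty
  refine (hd.congr fun τ => ?_).trans (le_of_eq ?_)
  · simp only [Function.comp_apply, zero_add, h0, smul_eq_mul, eq_cuspFunction τ one_ne_zero hper]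
    ring
  · simp

theorem tendsto_E2 : Tendsto E2 atImInfty (𝓝 1) := by
  have h := (tendsto_E2_sub_one_div.mul (qParam_tendsto_atImInfty one_pos)).add_const 1
  simp only [mul_zero, zero_add] at h
  refine h.congr fun τ => ?_
  rw [div_mul_cancel₀ _ (by exact Complex.exp_ne_zero _), sub_add_cancel]

/-! ### The forms `e₁` and `e₂` under `S` and `T` -/

theorem mdifferentiable_e₁ : MDiff e₁ := by
  have h := mdifferentiable_comp_affine E2_mdifferentiable two_pos 0
  simp only [Complex.ofReal_ofNat, Complex.ofReal_zero, add_zero] at h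
  exact (mdifferentiable_const.mul h).sub E2_mdifferentiable

theorem mdifferentiable_e₂ : MDiff e₂ := by
  have h := mdifferentiable_comp_affine E2_mdifferentiable one_half_pos 0
  have e (τ : ℍ) : ((1 / 2 : ℝ) : ℂ) * τ + (0 : ℝ) = τ / 2 := by push_cast; ring
  simp only [e] at h
  exact E2_mdifferentiable.sub (mdifferentiable_const.mul h)

theorem tendsto_E2_two_mul : Tendsto (fun τ : ℍ => E2 (ofComplex (2 * τ))) atImInfty (𝓝 1) := by
  have h := tendsto_E2.comp (tendsto_affine_atImInfty two_pos 0)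
  simpa [Function.comp_def] using h

theorem tendsto_half_atImInfty :
    Tendsto (fun τ : ℍ => ofComplex (τ / 2)) atImInfty atImInfty := by
  have h := tendsto_affine_atImInfty one_half_pos 0
  have e (τ : ℍ) : ((1 / 2 : ℝ) : ℂ) * τ + (0 : ℝ) = τ / 2 := by push_cast; ring
  simpa only [e] using h

theorem tendsto_e₁ : Tendsto e₁ atImInfty (𝓝 1) := by
  have h := (tendsto_E2_two_mul.const_mul 2).sub tendsto_E2
  norm_num at h
  exact h

theorem tendsto_e₂ : Tendsto e₂ atImInfty (𝓝 (1 / 2)) := by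
  have h := tendsto_E2.sub ((tendsto_E2.comp tendsto_half_atImInfty).const_mul (1 / 2))
  rw [show (1 : ℂ) - 1 / 2 * 1 = 1 / 2 by norm_num] at h
  exact h.congr fun τ => by simp [e₂]

theorem coe_ofComplex_of_im_pos {w : ℂ} (hw : 0 < w.im) : (ofComplex w : ℂ) = w := by
  rw [ofComplex_apply_of_im_pos hw]

theorem qParam_one_ofComplex_half (τ : ℍ) :
    Function.Periodic.qParam 1 (ofComplex (τ / 2 : ℂ)) = Function.Periodic.qParam 2 τ := by
  rw [coe_ofComplex_of_im_pos (by simpa using τ.im_pos)]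
  simp [Function.Periodic.qParam]
  ring_nf

/-- `e₁ - 2 e₂` vanishes at `i∞` to exact order one in the local parameter `q^{1/2}`. -/
theorem tendsto_e₁_sub_two_mul_e₂_div :
    Tendsto (fun τ : ℍ => (e₁ τ - 2 * e₂ τ) / Function.Periodic.qParam 2 τ)
      atImInfty (𝓝 (-24)) := by
  have hq1 (τ : ℍ) : Function.Periodic.qParam 1 τ = Function.Periodic.qParam 2 τ ^ 2 := by
    simp [Function.Periodic.qParam, ← Complex.exp_nat_mul]
    ring_nf
  have hq2 (τ : ℍ) : Function.Periodic.qParam 1 (ofComplex (2 * τ : ℂ)) =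
      Function.Periodic.qParam 2 τ ^ 4 := by
    rw [coe_ofComplex_of_im_pos (by simpa using τ.im_pos)]
    simp [Function.Periodic.qParam, ← Complex.exp_nat_mul]
    ring_nf
  have hq : Tendsto (fun τ : ℍ => Function.Periodic.qParam 2 τ) atImInfty (𝓝 0) :=
    qParam_tendsto_atImInfty two_pos
  have A := tendsto_E2_sub_one_div.comp (tendsto_affine_atImInfty two_pos 0)
  simp only [Function.comp_def, Complex.ofReal_ofNat, Complex.ofReal_zero, add_zero, hq2] at A
  have B := tendsto_E2_sub_one_div
  have C := tendsto_E2_sub_one_div.comp tendsto_half_atImInfty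
  simp only [Function.comp_def, qParam_one_ofComplex_half] at C
  have h := (((A.const_mul 2).mul (hq.pow 3)).sub ((B.const_mul 3).mul hq)).add C
  norm_num at h
  refine h.congr fun τ => ?_
  have hne : Function.Periodic.qParam 2 τ ≠ 0 := Complex.exp_ne_zero _
  rw [hq1, e₁, e₂]
  field_simp
  ring

/-- The third division value of weight two, `E₂((τ + 1)/2)/2 - E₂(τ)`; together with `e₁` and
`-e₂` it is permuted by `SL₂(ℤ)`. -/
def e₃ (τ : ℍ) : ℂ := 1 / 2 * E2 (ofComplex ((τ + 1) / 2)) - E2 τ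

theorem mdifferentiable_e₃ : MDiff e₃ := by
  have h := mdifferentiable_comp_affine E2_mdifferentiable one_half_pos (1 / 2)
  have e (τ : ℍ) : ((1 / 2 : ℝ) : ℂ) * τ + (1 / 2 : ℝ) = (τ + 1) / 2 := by push_cast; ring
  simp only [e] at h
  exact (mdifferentiable_const.mul h).sub E2_mdifferentiable

theorem tendsto_e₃ : Tendsto e₃ atImInfty (𝓝 (-1 / 2)) := by
  have h := tendsto_affine_atImInfty one_half_pos (1 / 2)
  have e (τ : ℍ) : ((1 / 2 : ℝ) : ℂ) * τ + (1 / 2 : ℝ) = (τ + 1) / 2 := by push_cast; ring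
  simp only [e] at h
  have h := ((tendsto_E2.comp h).const_mul (1 / 2)).sub tendsto_E2
  norm_num at h
  convert h using 1
  · ext τ; simp [e₃]
  · norm_num

theorem slash_T_apply (f : ℍ → ℂ) (k : ℤ) (τ : ℍ) :
    (f ∣[k] ModularGroup.T) τ = f (ofComplex (τ + 1)) := by
  have e : ofComplex ((τ : ℂ) + 1) = ModularGroup.T • τ := by
    rw [← ofComplex_apply (ModularGroup.T • τ), modular_T_smul]
    simp [add_comm]
  rw [SL_slash_apply, ModularGroup.denom_apply, e]
  simp [ModularGroup.T]

theorem slash_S_apply (f : ℍ → ℂ) (k : ℤ) (τ : ℍ) :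
    (f ∣[k] ModularGroup.S) τ = f (ofComplex (-1 / τ)) * (τ : ℂ) ^ (-k) := by
  have e : ofComplex (-1 / (τ : ℂ)) = ModularGroup.S • τ := by
    rw [← ofComplex_apply (ModularGroup.S • τ), modular_S_smul]
    congr 1
    simp [neg_div, inv_neg]
  rw [SL_slash_apply, ModularGroup.denom_apply, e]
  simp [ModularGroup.S]

theorem im_neg_one_div_pos (τ : ℍ) : 0 < (-1 / (τ : ℂ)).im := by
  have h := (ModularGroup.S • τ).im_pos
  rw [modular_S_smul] at h
  simpa [neg_div, inv_neg] using h

theorem e₁_slash_T : e₁ ∣[(2 : ℤ)] ModularGroup.T = e₁ := by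
  ext τ
  have h2 : 0 < (2 * (τ : ℂ)).im := by simpa using τ.im_pos
  rw [slash_T_apply, e₁, e₁, coe_ofComplex_of_im_pos (by simpa using τ.im_pos),
    E2_ofComplex_add_one τ.im_pos, show 2 * ((τ : ℂ) + 1) = 2 * τ + 1 + 1 by ring,
    E2_ofComplex_add_one (by simpa using h2), E2_ofComplex_add_one h2, ofComplex_apply]

theorem e₂_slash_T : e₂ ∣[(2 : ℤ)] ModularGroup.T = -e₃ := by
  ext τ
  rw [slash_T_apply, e₂, Pi.neg_apply, e₃, coe_ofComplex_of_im_pos (by simpa using τ.im_pos),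
    E2_ofComplex_add_one τ.im_pos, ofComplex_apply]
  ring

theorem e₃_slash_T : e₃ ∣[(2 : ℤ)] ModularGroup.T = -e₂ := by
  ext τ
  rw [slash_T_apply, e₃, Pi.neg_apply, e₂, coe_ofComplex_of_im_pos (by simpa using τ.im_pos),
    E2_ofComplex_add_one τ.im_pos, ofComplex_apply,
    show ((τ : ℂ) + 1 + 1) / 2 = τ / 2 + 1 by ring,
    E2_ofComplex_add_one (by simpa using τ.im_pos)]
  ring

theorem e₁_slash_S : e₁ ∣[(2 : ℤ)] ModularGroup.S = -e₂ := by
  ext τ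
  have h2 : 0 < ((τ : ℂ) / 2).im := by simpa using τ.im_pos
  have h0 := ne_zero τ
  rw [slash_S_apply, e₁, Pi.neg_apply, e₂, coe_ofComplex_of_im_pos (im_neg_one_div_pos τ),
    show 2 * (-1 / (τ : ℂ)) = -1 / (τ / 2) by field_simp, E2_ofComplex_neg_one_div h2,
    E2_ofComplex_neg_one_div τ.im_pos, ofComplex_apply, zpow_neg, zpow_ofNat]
  field_simp
  ring

theorem e₂_slash_S : e₂ ∣[(2 : ℤ)] ModularGroup.S = -e₁ := by
  ext τ
  have h2 : 0 < (2 * (τ : ℂ)).im := by simpa using τ.im_pos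
  have h0 := ne_zero τ
  rw [slash_S_apply, e₂, Pi.neg_apply, e₁, coe_ofComplex_of_im_pos (im_neg_one_div_pos τ),
    show (-1 / (τ : ℂ)) / 2 = -1 / (2 * τ) by field_simp, E2_ofComplex_neg_one_div h2,
    E2_ofComplex_neg_one_div τ.im_pos, ofComplex_apply, zpow_neg, zpow_ofNat]
  field_simp
  ring

theorem e₃_slash_S : e₃ ∣[(2 : ℤ)] ModularGroup.S = e₃ := by
  ext τ
  have h0 := ne_zero τ
  -- With `w = (τ + 1)/2` one has `(-1/τ + 1)/2 = (w - 1)/(2 w - 1)`, which is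
  -- reached from `w` by a unit translation, an inversion, a translation and an inversion.
  set w : ℍ := ofComplex ((τ + 1) / 2 - 1) with hw
  have hwim : 0 < (((τ : ℂ) + 1) / 2 - 1).im := by simpa using τ.im_pos
  have hwc : (w : ℂ) = (τ + 1) / 2 - 1 := coe_ofComplex_of_im_pos hwim
  have h1 : E2 (ofComplex (((τ : ℂ) + 1) / 2)) = E2 w := by
    rw [hw, ← E2_ofComplex_add_one hwim, sub_add_cancel]
  have hw0 := ne_zero w
  have him := im_neg_one_div_pos w
  have h2 : -1 / (w : ℂ) = (-1 / w - 1 - 1) + 1 + 1 := by ring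
  have h3 : E2 (ofComplex (-1 / (w : ℂ) - 1 - 1)) = E2 (ofComplex (-1 / (w : ℂ))) := by
    rw [h2, E2_ofComplex_add_one (by simpa using him), E2_ofComplex_add_one (by simpa using him),
      ← h2]
  have hden : -1 / (w : ℂ) - 1 - 1 = -τ / w := by
    field_simp
    rw [hwc]
    ring
  have h4 : (-1 / (τ : ℂ) + 1) / 2 = -1 / (-1 / (w : ℂ) - 1 - 1) := by
    rw [hden]
    field_simp
    rw [hwc]
    ring
  rw [slash_S_apply, e₃, e₃, coe_ofComplex_of_im_pos (im_neg_one_div_pos τ), h4,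
    E2_ofComplex_neg_one_div (by simpa using him), h3, E2_ofComplex_neg_one_div w.im_pos,
    E2_ofComplex_neg_one_div τ.im_pos, ofComplex_apply, ofComplex_apply, h1, hden, zpow_neg,
    zpow_ofNat]
  field_simp
  rw [hwc]
  ring

theorem levelOne_weight_two_eq_zero {f : ℍ → ℂ} (hf : MDiff f) {l : ℂ}
    (hl : Tendsto f atImInfty (𝓝 l)) (hS : f ∣[(2 : ℤ)] ModularGroup.S = f)
    (hT : f ∣[(2 : ℤ)] ModularGroup.T = f) : f = 0 := by
  have hγ := SlashInvariantForm.slash_action_generators_SL2Z hS hT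
  let F : ModularForm 𝒮ℒ 2 :=
    { toFun := f
      slash_action_eq' := fun _ ⟨γ, h⟩ => h ▸ hγ γ
      holo' := hf
      bdd_at_cusps' := fun {c} hc => by
        rw [OnePoint.isBoundedAt_iff_forall_SL2Z hc]
        intro γ _
        rw [hγ γ]
        exact hl.isBigO_one ℝ }
  have h : F = 0 := rank_zero_iff_forall_zero.mp ModularForm.levelOne_weight_two_rank_zero F
  exact congrArg (fun G : ModularForm 𝒮ℒ 2 => (G : ℍ → ℂ)) h

/-- The three division values sum to zero: their sum is a form of weight two and level one. -/
theorem e₃_eq : e₃ = e₂ - e₁ := by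
  have h : e₁ - e₂ + e₃ = 0 := by
    refine levelOne_weight_two_eq_zero
      ((mdifferentiable_e₁.sub mdifferentiable_e₂).add mdifferentiable_e₃)
      ((tendsto_e₁.sub tendsto_e₂).add tendsto_e₃) ?_ ?_
    · rw [sub_eq_add_neg, SlashAction.add_slash, SlashAction.add_slash, ← neg_one_smul ℂ e₂,
        SL_smul_slash, e₁_slash_S, e₂_slash_S, e₃_slash_S]
      simp; ring
    · rw [sub_eq_add_neg, SlashAction.add_slash, SlashAction.add_slash, ← neg_one_smul ℂ e₂,
        SL_smul_slash, e₁_slash_T, e₂_slash_T, e₃_slash_T]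
      simp; ring
  have h' : e₃ = e₂ - e₁ + (e₁ - e₂ + e₃) := by ring
  rw [h', h, add_zero]

/-! ### The action of `SL₂(ℤ)` through `SL₂(𝔽₂)` -/

/-- Reduction `SL₂(ℤ) → SL₂(𝔽₂)`. -/
abbrev modTwo : SL(2, ℤ) →* SL(2, ZMod 2) :=
  Matrix.SpecialLinearGroup.map (Int.castRingHom (ZMod 2))

/-- The weight two division value attached to a vector of `𝔽₂²`: the three nonzero vectors
`(0, 1)`, `(1, 0)`, `(1, 1)` give `e₁`, `-e₂`, `e₂ - e₁`, and the zero vector gives `0`. -/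
def divisionValue (v : Fin 2 → ZMod 2) : ℍ → ℂ :=
  if v 0 = 0 then if v 1 = 0 then 0 else e₁ else if v 1 = 0 then -e₂ else e₂ - e₁

theorem neg_slash_SL (f : ℍ → ℂ) (k : ℤ) (γ : SL(2, ℤ)) : (-f) ∣[k] γ = -(f ∣[k] γ) := by
  rw [← neg_one_smul ℂ f, SL_smul_slash, neg_one_smul]

theorem sub_slash_SL (f g : ℍ → ℂ) (k : ℤ) (γ : SL(2, ℤ)) :
    (f - g) ∣[k] γ = f ∣[k] γ - g ∣[k] γ := by
  rw [sub_eq_add_neg, SlashAction.add_slash, neg_slash_SL, sub_eq_add_neg]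

/-- `SL₂(ℤ)` permutes the division values through the right action of `SL₂(𝔽₂)` on row vectors. -/
theorem divisionValue_slash (v : Fin 2 → ZMod 2) (γ : SL(2, ℤ)) :
    divisionValue v ∣[(2 : ℤ)] γ = divisionValue (Matrix.vecMul v (modTwo γ).1) := by
  have hγ : γ ∈ Subgroup.closure {ModularGroup.S, ModularGroup.T} := by
    simp [SpecialLinearGroup.SL2Z_generators]
  induction hγ using Subgroup.closure_induction generalizing v with
  | one => simp
  | mem g hg =>
    have hv (x : ZMod 2) : x = 0 ∨ x = 1 := by revert x; decide
    have hS : (modTwo ModularGroup.S).1 = !![0, 1; 1, 0] := by decide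
    have hT : (modTwo ModularGroup.T).1 = !![1, 1; 0, 1] := by decide
    rcases hg with rfl | rfl
    · rw [hS]
      rcases hv (v 0) with h0 | h0 <;> rcases hv (v 1) with h1 | h1 <;>
        simp only [divisionValue, Matrix.vecMul, dotProduct, Fin.sum_univ_two, h0, h1] <;>
        simp [sub_slash_SL, e₁_slash_S, e₂_slash_S, SlashAction.zero_slash]
      ring
    · rw [hT]
      rcases hv (v 0) with h0 | h0 <;> rcases hv (v 1) with h1 | h1 <;>
        simp only [divisionValue, Matrix.vecMul, dotProduct, Fin.sum_univ_two, h0, h1] <;>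
        simp [sub_slash_SL, e₁_slash_T, e₂_slash_T, e₃_eq, SlashAction.zero_slash,
          CharTwo.add_self_eq_zero]
  | mul g h _ _ ig ih =>
    rw [SlashAction.slash_mul, ig, ih, map_mul, Matrix.SpecialLinearGroup.coe_mul,
      Matrix.vecMul_vecMul]
  | inv g _ ig =>
    have h := ig (Matrix.vecMul v (modTwo g⁻¹).1)
    rw [Matrix.vecMul_vecMul, ← Matrix.SpecialLinearGroup.coe_mul, ← map_mul, inv_mul_cancel,
      map_one, Matrix.SpecialLinearGroup.coe_one, Matrix.vecMul_one] at h
    rw [← h, ← SlashAction.slash_mul, mul_inv_cancel, SlashAction.slash_one]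

/-- The matrices of the six elements of `SL₂(𝔽₂)` acting on the pair `(e₁, e₂)`. -/
def IsDivisionMatrix (a b c d : ℂ) : Prop :=
  (a = 1 ∧ b = 0 ∧ c = 0 ∧ d = 1) ∨ (a = 1 ∧ b = 0 ∧ c = 1 ∧ d = -1) ∨
  (a = 0 ∧ b = -1 ∧ c = -1 ∧ d = 0) ∨ (a = 0 ∧ b = -1 ∧ c = 1 ∧ d = -1) ∨
  (a = -1 ∧ b = 1 ∧ c = -1 ∧ d = 0) ∨ (a = -1 ∧ b = 1 ∧ c = 0 ∧ d = 1)

theorem e₁_slash (γ : SL(2, ℤ)) : e₁ ∣[(2 : ℤ)] γ = divisionValue ((modTwo γ).1 1) := by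
  have h := divisionValue_slash ![0, 1] γ
  have h0 : divisionValue ![0, 1] = e₁ := by simp [divisionValue]
  rw [h0] at h
  rw [h]
  congr 1
  ext j
  simp [Matrix.vecMul, dotProduct, Fin.sum_univ_two]

theorem e₂_slash (γ : SL(2, ℤ)) : e₂ ∣[(2 : ℤ)] γ = -divisionValue ((modTwo γ).1 0) := by
  have h := divisionValue_slash ![1, 0] γ
  have h0 : divisionValue ![1, 0] = -e₂ := by simp [divisionValue]
  rw [h0, neg_slash_SL] at h
  rw [← neg_neg (e₂ ∣[(2 : ℤ)] γ), h]
  congr 2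
  ext j
  simp [Matrix.vecMul, dotProduct, Fin.sum_univ_two]

/-- The matrix by which `γ` acts on `(e₁, e₂)` depends only on its reduction `N`; its first row is
`(1, 0)` exactly when `γ` lies in `Γ₀(2)`. -/
theorem exists_divisionMatrix (N : SL(2, ZMod 2)) : ∃ a b c d : ℂ, IsDivisionMatrix a b c d ∧
    (a = 1 ↔ N.1 1 0 = 0) ∧ ∀ γ : SL(2, ℤ), modTwo γ = N → e₁ ∣[(2 : ℤ)] γ = a • e₁ + b • e₂ ∧
      e₂ ∣[(2 : ℤ)] γ = c • e₁ + d • e₂ := by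
  have hv (x : ZMod 2) : x = 0 ∨ x = 1 := by revert x; decide
  have hdet := N.2
  rw [Matrix.det_fin_two] at hdet
  suffices h : ∃ a b c d : ℂ, IsDivisionMatrix a b c d ∧
      (a = 1 ↔ N.1 1 0 = 0) ∧ divisionValue (N.1 1) = a • e₁ + b • e₂ ∧
        -divisionValue (N.1 0) = c • e₁ + d • e₂ by
    obtain ⟨a, b, c, d, h, ha, h1, h2⟩ := h
    refine ⟨a, b, c, d, h, ha, fun γ hγ => ?_⟩
    rw [e₁_slash, e₂_slash, hγ]
    exact ⟨h1, h2⟩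
  unfold IsDivisionMatrix
  rcases hv (N.1 0 0) with h1 | h1 <;> rcases hv (N.1 0 1) with h2 | h2 <;>
    rcases hv (N.1 1 0) with h3 | h3 <;> rcases hv (N.1 1 1) with h4 | h4 <;>
    simp only [h1, h2, h3, h4] at hdet <;>
    first
    | (exfalso; revert hdet; decide)
    | (clear hdet
       simp only [divisionValue, h1, h2, h3, h4, one_ne_zero, if_true, if_false]
       first
       | (refine ⟨1, 0, 0, 1, by norm_num, by norm_num, ?_, ?_⟩ <;> module)
       | (refine ⟨1, 0, 1, -1, by norm_num, by norm_num, ?_, ?_⟩ <;> module)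
       | (refine ⟨0, -1, -1, 0, by norm_num, by norm_num, ?_, ?_⟩ <;> module)
       | (refine ⟨0, -1, 1, -1, by norm_num, by norm_num, ?_, ?_⟩ <;> module)
       | (refine ⟨-1, 1, -1, 0, by norm_num, by norm_num, ?_, ?_⟩ <;> module)
       | (refine ⟨-1, 1, 0, 1, by norm_num, by norm_num, ?_, ?_⟩ <;> module))

theorem apply_smul_of_slash {f g : ℍ → ℂ} {k : ℤ} {γ : SL(2, ℤ)} (h : f ∣[k] γ = g) (τ : ℍ) :
    f (γ • τ) = ((γ 1 0 : ℂ) * τ + (γ 1 1 : ℂ)) ^ k * g τ := by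
  rw [← h, SL_slash_apply, ModularGroup.denom_apply, mul_comm, mul_assoc, ← zpow_add₀
    (factor_ne_zero γ τ), neg_add_cancel, zpow_zero, mul_one]

theorem slash_eq_of_apply_smul {f g : ℍ → ℂ} {k : ℤ} {γ : SL(2, ℤ)}
    (h : ∀ τ : ℍ, f (γ • τ) = ((γ 1 0 : ℂ) * τ + (γ 1 1 : ℂ)) ^ k * g τ) : f ∣[k] γ = g := by
  ext τ
  rw [SL_slash_apply, ModularGroup.denom_apply, h τ, mul_comm, ← mul_assoc, ← zpow_add₀
    (factor_ne_zero γ τ), neg_add_cancel, zpow_zero, one_mul]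

/-! ### The product formula for `η¹²` -/

/-- The twelfth power of Dedekind's `η` on the upper half-plane. -/
def etaPow : ℍ → ℂ := fun τ => eta τ ^ 12

theorem etaPow_ne_zero (τ : ℍ) : etaPow τ ≠ 0 := pow_ne_zero _ (eta_ne_zero τ.2)

theorem mdifferentiable_etaPow : MDiff etaPow := by
  rw [mdifferentiable_iff]
  have h : DifferentiableOn ℂ (fun z => eta z ^ 12) {z | 0 < z.im} := fun z hz =>
    ((differentiableAt_eta_of_mem_upperHalfPlaneSet hz).pow 12).differentiableWithinAt
  exact h.congr fun z hz => by simp [etaPow, ofComplex_apply_of_im_pos hz]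

theorem etaPow_eq (τ : ℍ) : etaPow τ =
    Function.Periodic.qParam 2 τ * (∏' n, (1 - eta_q n τ)) ^ 12 := by
  rw [etaPow, eta, mul_pow]
  congr 1
  simp only [Function.Periodic.qParam, ← Complex.exp_nat_mul]
  congr 1
  push_cast
  ring

theorem tendsto_etaPow_div :
    Tendsto (fun τ : ℍ => etaPow τ / Function.Periodic.qParam 2 τ) atImInfty (𝓝 1) := by
  have htprod : Tendsto (fun q : ℂ ↦ ∏' n : ℕ, (1 - q ^ (n + 1))) (𝓝 0) (𝓝 1) := by
    have := tendsto_tprod_one_add_of_dominated_convergence (𝓕 := 𝓝 0) (g := 0)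
      (f := fun (q : ℂ) (n : ℕ) ↦ -q ^ (n + 1)) (bound := fun n ↦ (1 / 2 : ℝ) ^ (n + 1))
    simp only [Pi.zero_apply, norm_neg, norm_pow, add_zero, tprod_one] at this
    simp_rw [sub_eq_add_neg]
    refine this
      (by simpa only [pow_succ'] using (summable_geometric_of_abs_lt_one (by norm_num)).mul_left _)
      (fun k ↦ by simpa using ((continuous_pow (M := ℂ) (k + 1)).tendsto 0).neg) ?_
    filter_upwards [Metric.ball_mem_nhds (0 : ℂ) (by norm_num : (0 : ℝ) < 1 / 2)] with q hq k
    exact pow_le_pow_left₀ (norm_nonneg _) (mem_ball_zero_iff.mp hq).le _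
  have h := (htprod.comp (qParam_tendsto_atImInfty zero_lt_one)).pow 12
  rw [one_pow] at h
  refine h.congr fun τ => ?_
  have hne : Function.Periodic.qParam 2 τ ≠ 0 := Complex.exp_ne_zero _
  rw [etaPow_eq, mul_div_cancel_left₀ _ hne]
  simp only [Function.comp_apply]

theorem etaPow_slash_T : etaPow ∣[(6 : ℤ)] ModularGroup.T = -etaPow := by
  ext τ
  rw [slash_T_apply, Pi.neg_apply, etaPow_eq, etaPow_eq,
    coe_ofComplex_of_im_pos (by simpa using τ.im_pos)]
  have hq : Function.Periodic.qParam 2 ((τ : ℂ) + 1) = -Function.Periodic.qParam 2 τ := by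
    simp only [Function.Periodic.qParam]
    rw [← neg_one_mul, ← Complex.exp_pi_mul_I, ← Complex.exp_add]
    congr 1
    push_cast
    ring
  have hn (n : ℕ) : eta_q n ((τ : ℂ) + 1) = eta_q n τ := by
    simp only [eta_q]
    congr 1
    simp only [Function.Periodic.qParam]
    rw [show 2 * Real.pi * Complex.I * ((τ : ℂ) + 1) / (1 : ℝ) =
      2 * Real.pi * Complex.I * τ / (1 : ℝ) + 2 * Real.pi * Complex.I by push_cast; ring,
      Complex.exp_periodic]
  simp only [hq, hn]
  ring

theorem etaPow_slash_S : etaPow ∣[(6 : ℤ)] ModularGroup.S = -etaPow := by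
  ext τ
  have h0 := ne_zero τ
  have h := eta_comp_eq_csqrt_I_inv τ.2
  simp only [Function.comp_apply, Pi.smul_apply, Pi.mul_apply, smul_eq_mul] at h
  have hs (z : ℂ) : Complex.sqrt z ^ 12 = z ^ 6 := by
    rw [show (12 : ℕ) = 2 * 6 by norm_num, pow_mul]; simp [Complex.sqrt]
  rw [slash_S_apply, Pi.neg_apply, etaPow, etaPow, coe_ofComplex_of_im_pos (im_neg_one_div_pos τ),
    h, mul_pow, mul_pow, inv_pow, hs, hs, zpow_neg, zpow_ofNat,
    show Complex.I ^ 6 = -1 by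
      rw [show (6 : ℕ) = 2 * 3 by norm_num, pow_mul, Complex.I_sq]
      norm_num]
  field_simp

/-- The ratio of the two sides is a level one form of weight zero, hence equal to its limit. -/
theorem division_product_eq (τ : ℍ) :
    (e₁ τ + e₂ τ) * (e₁ τ - 2 * e₂ τ) * (2 * e₁ τ - e₂ τ) = -54 * etaPow τ := by
  set P : ℍ → ℂ := (e₁ + e₂) * (e₁ - (2 : ℂ) • e₂) * ((2 : ℂ) • e₁ - e₂) with hP
  have hPd : MDiff P := by
    have h1 := mdifferentiable_e₁
    have h2 := mdifferentiable_e₂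
    exact ((h1.add h2).mul (h1.sub (h2.const_smul 2))).mul ((h1.const_smul 2).sub h2)
  have hPS : P ∣[(6 : ℤ)] ModularGroup.S = -P := by
    rw [hP, show (6 : ℤ) = 2 + 2 + 2 by norm_num, mul_slash_SL2, mul_slash_SL2]
    simp only [SlashAction.add_slash, sub_slash_SL, SL_smul_slash, e₁_slash_S, e₂_slash_S]
    ext z
    simp only [Pi.mul_apply, Pi.add_apply, Pi.sub_apply, Pi.neg_apply, Pi.smul_apply, smul_eq_mul]
    ring
  have hPT : P ∣[(6 : ℤ)] ModularGroup.T = -P := by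
    rw [hP, show (6 : ℤ) = 2 + 2 + 2 by norm_num, mul_slash_SL2, mul_slash_SL2]
    simp only [SlashAction.add_slash, sub_slash_SL, SL_smul_slash, e₁_slash_T, e₂_slash_T, e₃_eq]
    ext z
    simp only [Pi.mul_apply, Pi.add_apply, Pi.sub_apply, Pi.neg_apply, Pi.smul_apply, smul_eq_mul]
    ring
  have hγ : ∀ γ : SL(2, ℤ), (P / etaPow) ∣[(0 : ℤ)] γ = P / etaPow :=
    SlashInvariantForm.slash_action_generators_SL2Z
      (by rw [show (0 : ℤ) = 6 - 6 by norm_num, div_slash_SL2, hPS, etaPow_slash_S, neg_div_neg_eq])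
      (by rw [show (0 : ℤ) = 6 - 6 by norm_num, div_slash_SL2, hPT, etaPow_slash_T, neg_div_neg_eq])
  have hlim : Tendsto (P / etaPow) atImInfty (𝓝 (-54)) := by
    have h := (((tendsto_e₁.add tendsto_e₂).mul tendsto_e₁_sub_two_mul_e₂_div).mul
      ((tendsto_e₁.const_mul 2).sub tendsto_e₂)).div tendsto_etaPow_div one_ne_zero
    norm_num at h
    refine h.congr fun z => ?_
    have hne : Function.Periodic.qParam 2 z ≠ 0 := Complex.exp_ne_zero _
    have hne' := etaPow_ne_zero z
    simp only [hP, Pi.div_apply, Pi.mul_apply, Pi.add_apply, Pi.sub_apply, Pi.smul_apply,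
      smul_eq_mul]
    field_simp
  let F : ModularForm 𝒮ℒ 0 :=
    { toFun := P / etaPow
      slash_action_eq' := fun _ ⟨γ, h⟩ => h ▸ hγ γ
      holo' := hPd.div mdifferentiable_etaPow etaPow_ne_zero
      bdd_at_cusps' := fun {c} hc => by
        rw [OnePoint.isBoundedAt_iff_forall_SL2Z hc]
        intro γ _
        rw [hγ γ]
        exact hlim.isBigO_one ℝ }
  obtain ⟨c, hc⟩ := ModularFormClass.levelOne_weight_zero_const F
  have hc' : P / etaPow = Function.const ℍ c := hc
  rw [hc'] at hlim
  have hc54 : c = -54 := tendsto_nhds_unique tendsto_const_nhds hlim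
  have h := congrFun hc' τ
  rw [Pi.div_apply, Function.const_apply, div_eq_iff (etaPow_ne_zero τ), hc54] at h
  rw [← h, hP]
  simp

theorem e₁_add_e₂_ne_zero (τ : ℍ) : e₁ τ + e₂ τ ≠ 0 := fun h => by
  have := division_product_eq τ
  simp [h, etaPow_ne_zero] at this

theorem e₁_sub_two_mul_e₂_ne_zero (τ : ℍ) : e₁ τ - 2 * e₂ τ ≠ 0 := fun h => by
  have := division_product_eq τ
  simp [h, etaPow_ne_zero] at this

theorem Δ₆_eq (τ : ℍ × ℍ) : Δ₆ τ = 1 / 2916 * (f₁₁ τ + f₁₂ τ + f₂₁ τ + f₂₂ τ) *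
    (f₁₁ τ - 2 * f₁₂ τ - 2 * f₂₁ τ + 4 * f₂₂ τ) *
    (4 * f₁₁ τ - 2 * f₁₂ τ - 2 * f₂₁ τ + f₂₂ τ) := by
  have h1 := division_product_eq τ.1
  have h2 := division_product_eq τ.2
  simp only [etaPow] at h1 h2
  simp only [Δ₆, f₁₁, f₁₂, f₂₁, f₂₂]
  linear_combination (-1 / 2916 : ℂ) * ((e₁ τ.2 + e₂ τ.2) * (e₁ τ.2 - 2 * e₂ τ.2) *
    (2 * e₁ τ.2 - e₂ τ.2)) * h1 + (54 / 2916) * ModularForm.eta τ.1 ^ 12 * h2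

/-! ### Modular forms for `Γ(2)` -/

/-- A holomorphic function that is invariant under a finite index subgroup `Γ` of `SL₂(ℤ)`, and all
of whose translates are bounded at `i∞`, is a modular form for `Γ`. -/
def modularFormOfSlash (Γ : Subgroup SL(2, ℤ)) [Γ.FiniteIndex] {k : ℤ} (f : ℍ → ℂ) (hf : MDiff f)
    (hΓ : ∀ γ ∈ Γ, f ∣[k] γ = f) (hb : ∀ γ : SL(2, ℤ), IsBoundedAtImInfty (f ∣[k] γ)) :
    ModularForm (Γ.map (Matrix.SpecialLinearGroup.mapGL ℝ)) k where
  toFun := f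
  slash_action_eq' := fun _ ⟨γ, h, h'⟩ => h' ▸ hΓ γ h
  holo' := hf
  bdd_at_cusps' := fun {c} hc => by
    rw [Subgroup.IsArithmetic.isCusp_iff_isCusp_SL2Z] at hc
    rw [OnePoint.isBoundedAt_iff_forall_SL2Z hc]
    exact fun γ _ => hb γ

/-- Modular forms of weight `k` for the principal congruence subgroup `Γ(2)`. -/
abbrev PrincipalForm (k : ℤ) : Type :=
  ModularForm ((Gamma 2).map (Matrix.SpecialLinearGroup.mapGL ℝ)) k

theorem PrincipalForm.slash {k : ℤ} (f : PrincipalForm k) {γ : SL(2, ℤ)} (hγ : γ ∈ Gamma 2) :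
    (f : ℍ → ℂ) ∣[k] γ = f :=
  f.slash_action_eq' _ ⟨γ, hγ, rfl⟩

theorem PrincipalForm.isBoundedAtImInfty_slash {k : ℤ} (f : PrincipalForm k) (γ : SL(2, ℤ)) :
    IsBoundedAtImInfty ((f : ℍ → ℂ) ∣[k] γ) := by
  have hc : IsCusp (Matrix.SpecialLinearGroup.mapGL ℝ γ • OnePoint.infty) 𝒮ℒ :=
    isCusp_SL2Z_iff'.mpr ⟨γ, rfl⟩
  refine (OnePoint.isBoundedAt_iff_forall_SL2Z hc).mp (f.bdd_at_cusps' ?_) γ rfl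
  rwa [Subgroup.IsArithmetic.isCusp_iff_isCusp_SL2Z]

/-- `Γ₀(2)` is the union of the cosets `Γ(2)` and `Γ(2) T`. -/
theorem mem_Gamma_two_or_mul_T_inv_mem {γ : SL(2, ℤ)} (h : (modTwo γ).1 1 0 = 0) :
    γ ∈ Gamma 2 ∨ γ * ModularGroup.T⁻¹ ∈ Gamma 2 := by
  have key : ∀ N : SL(2, ZMod 2), N.1 1 0 = 0 →
      N = 1 ∨ N * (modTwo ModularGroup.T)⁻¹ = 1 := by decide
  rcases key _ h with h | h
  · exact Or.inl h
  · exact Or.inr (by rw [Gamma_mem', map_mul, map_inv]; exact h)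

theorem tendsto_divisionMatrix (a b : ℂ) :
    Tendsto (a • e₁ + b • e₂) atImInfty (𝓝 (a + b / 2)) := by
  have h := (tendsto_e₁.const_mul a).add (tendsto_e₂.const_mul b)
  rw [show a * 1 + b * (1 / 2) = a + b / 2 by ring] at h
  exact h

theorem isBoundedAtImInfty_e₁_slash (γ : SL(2, ℤ)) : IsBoundedAtImInfty (e₁ ∣[(2 : ℤ)] γ) := by
  obtain ⟨a, b, c, d, -, -, h⟩ := exists_divisionMatrix (modTwo γ)
  rw [(h γ rfl).1]
  exact (tendsto_divisionMatrix a b).isBigO_one ℝ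

theorem isBoundedAtImInfty_e₂_slash (γ : SL(2, ℤ)) : IsBoundedAtImInfty (e₂ ∣[(2 : ℤ)] γ) := by
  obtain ⟨a, b, c, d, -, -, h⟩ := exists_divisionMatrix (modTwo γ)
  rw [(h γ rfl).2]
  exact (tendsto_divisionMatrix c d).isBigO_one ℝ

theorem e₁_slash_of_mem_Gamma_two {γ : SL(2, ℤ)} (hγ : γ ∈ Gamma 2) : e₁ ∣[(2 : ℤ)] γ = e₁ := by
  rw [e₁_slash, Gamma_mem'.mp hγ]
  simp [divisionValue]

theorem e₂_slash_of_mem_Gamma_two {γ : SL(2, ℤ)} (hγ : γ ∈ Gamma 2) : e₂ ∣[(2 : ℤ)] γ = e₂ := by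
  rw [e₂_slash, Gamma_mem'.mp hγ]
  simp [divisionValue]

/-- `e₁ + e₂` as a modular form for `Γ(2)`; it does not vanish at `i∞`. -/
def addForm : PrincipalForm 2 :=
  modularFormOfSlash (Gamma 2) (e₁ + e₂) (mdifferentiable_e₁.add mdifferentiable_e₂)
    (fun γ hγ => by
      rw [SlashAction.add_slash, e₁_slash_of_mem_Gamma_two hγ, e₂_slash_of_mem_Gamma_two hγ])
    (fun γ => by
      rw [SlashAction.add_slash]
      exact (isBoundedAtImInfty_e₁_slash γ).add (isBoundedAtImInfty_e₂_slash γ))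

/-- `e₁ - 2 e₂` decays no faster than the local parameter `q^{1/2}` at `i∞`. -/
theorem isBigO_e₁_sub_two_mul_e₂ :
    (fun τ : ℍ => Real.exp (-2 * Real.pi * τ.im / 2)) =O[atImInfty]
      (e₁ - (2 : ℂ) • e₂) := by
  have h : (fun τ : ℍ => Function.Periodic.qParam 2 τ) =O[atImInfty] (e₁ - (2 : ℂ) • e₂) := by
    refine Asymptotics.isBigO_of_div_tendsto_nhds
      (Eventually.of_forall fun τ h => absurd h (e₁_sub_two_mul_e₂_ne_zero τ)) (-24)⁻¹ ?_
    refine (tendsto_e₁_sub_two_mul_e₂_div.inv₀ (by norm_num)).congr fun τ => ?_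
    rw [inv_div]
    rfl
  refine h.norm_left.congr_left fun τ => ?_
  rw [Function.Periodic.norm_qParam, coe_im]

theorem two_mem_strictPeriods_Gamma_two :
    (2 : ℝ) ∈ ((Gamma 2).map (Matrix.SpecialLinearGroup.mapGL ℝ)).strictPeriods := by
  rw [strictPeriods_Gamma]
  simp

theorem PrincipalForm.exists_tendsto {k : ℤ} (f : PrincipalForm k) :
    ∃ l, Tendsto f atImInfty (𝓝 l) := by
  have h := (ModularFormClass.analyticAt_cuspFunction_zero f two_pos
    two_mem_strictPeriods_Gamma_two).continuousAt.tendsto.comp (qParam_tendsto_atImInfty two_pos)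
  exact ⟨_, h.congr fun τ => SlashInvariantFormClass.eq_cuspFunction f τ
    two_mem_strictPeriods_Gamma_two two_ne_zero⟩

/-- A modular form for `Γ(2)` that vanishes at `i∞` is divisible by `e₁ - 2 e₂`, whose only zero,
counted with multiplicity, is a simple one at `i∞`. -/
theorem exists_eq_e₁_sub_two_mul_e₂_mul {k : ℤ} (f : PrincipalForm k)
    (h0 : IsZeroAtImInfty (f : ℍ → ℂ)) :
    ∃ g : PrincipalForm (k - 2), ∀ τ, f τ = (e₁ τ - 2 * e₂ τ) * g τ := by
  set u : ℍ → ℂ := e₁ - (2 : ℂ) • e₂ with hu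
  have hu0 (τ : ℍ) : u τ ≠ 0 := e₁_sub_two_mul_e₂_ne_zero τ
  have hinv : ∀ γ ∈ Gamma 2, (⇑f / u) ∣[k - 2] γ = ⇑f / u := fun γ hγ => by
    rw [div_slash_SL2, f.slash hγ, hu, sub_slash_SL, SL_smul_slash,
      e₁_slash_of_mem_Gamma_two hγ, e₂_slash_of_mem_Gamma_two hγ]
  have hbd : IsBoundedAtImInfty (⇑f / u) := by
    have h1 : (f : ℍ → ℂ) =O[atImInfty] fun τ : ℍ => Real.exp (-2 * Real.pi * τ.im / 2) :=
      h0.exp_decay_atImInfty two_pos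
        (SlashInvariantFormClass.periodic_comp_ofComplex f two_mem_strictPeriods_Gamma_two) f.holo'
        (by simpa using f.isBoundedAtImInfty_slash 1)
    exact (Asymptotics.div_isBoundedUnder_of_isBigO
      (h1.trans isBigO_e₁_sub_two_mul_e₂)).isBigO_one ℝ
  refine ⟨modularFormOfSlash (Gamma 2) (⇑f / u) (f.holo'.div
    (mdifferentiable_e₁.sub (mdifferentiable_e₂.const_smul 2)) hu0) hinv fun γ => ?_, fun τ => ?_⟩
  · obtain ⟨a, b, c, d, h, ha, hslash⟩ := exists_divisionMatrix (modTwo γ)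
    obtain ⟨h1, h2⟩ := hslash γ rfl
    by_cases hN : a = 1
    · rcases mem_Gamma_two_or_mul_T_inv_mem (ha.mp hN) with hγ | hγ
      · rwa [hinv γ hγ]
      · rw [← inv_mul_cancel_right γ ModularGroup.T, SlashAction.slash_mul, hinv _ hγ]
        have hT : ((ModularGroup.T 1 0 : ℤ) : ℝ) = 0 := by simp [ModularGroup.T]
        exact hbd.slash _ hT
    · have hlim : Tendsto (u ∣[(2 : ℤ)] γ) atImInfty (𝓝 (a - 2 * c + (b - 2 * d) / 2)) := by
        have e : u ∣[(2 : ℤ)] γ = (a - 2 * c) • e₁ + (b - 2 * d) • e₂ := by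
          rw [hu, sub_slash_SL, SL_smul_slash, h1, h2]
          module
        rw [e]
        exact tendsto_divisionMatrix _ _
      have hne : a - 2 * c + (b - 2 * d) / 2 ≠ 0 := by
        unfold IsDivisionMatrix at h
        rcases h with h | h | h | h | h | h <;> obtain ⟨rfl, rfl, rfl, rfl⟩ := h <;>
          first
          | exact absurd rfl hN
          | norm_num
      rw [div_slash_SL2, div_eq_mul_inv]
      exact (f.isBoundedAtImInfty_slash γ).mul ((hlim.inv₀ hne).isBigO_one ℝ)
  · change _ = u τ * (f τ / u τ)
    rw [mul_div_cancel₀ _ (hu0 τ)]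

/-- The modular forms of weight `2 m` for `Γ(2)` are the homogeneous polynomials of degree `m` in
`e₁ + e₂` and `e₁ - 2 e₂`: after subtracting the multiple of `(e₁ + e₂) ^ m` with the same value at
`i∞` one can divide by `e₁ - 2 e₂`. -/
theorem PrincipalForm.exists_eq_sum (m : ℕ) (f : PrincipalForm (2 * m)) :
    ∃ c : ℕ → ℂ, ∀ τ, f τ =
      ∑ i ∈ Finset.range (m + 1), c i * (e₁ τ + e₂ τ) ^ i * (e₁ τ - 2 * e₂ τ) ^ (m - i) := by
  induction m with
  | zero =>
    obtain ⟨c, hc⟩ := ModularForm.eq_const_of_weight_zero (ModularForm.mcast (by simp) f)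
    refine ⟨fun _ => c, fun τ => ?_⟩
    simpa using congrFun hc τ
  | succ m ih =>
    obtain ⟨l, hl⟩ := f.exists_tendsto
    -- `e₁ + e₂` tends to `3 / 2` at `i∞`
    set a : ℂ := l / (3 / 2) ^ (m + 1) with ha
    set F : PrincipalForm (2 * (m + 1 : ℕ)) :=
      f - a • ModularForm.mcast (by push_cast; ring) (addForm.pow (m + 1)) with hF
    have hFa (τ : ℍ) : F τ = f τ - a * (e₁ τ + e₂ τ) ^ (m + 1) := by
      have h : (addForm.pow (m + 1) : ℍ → ℂ) τ = (e₁ τ + e₂ τ) ^ (m + 1) := by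
        rw [ModularForm.coe_pow]
        rfl
      rw [← h]
      rfl
    have hF0 : IsZeroAtImInfty (F : ℍ → ℂ) := by
      have h := hl.sub (((tendsto_e₁.add tendsto_e₂).pow (m + 1)).const_mul a)
      rw [show (1 : ℂ) + 1 / 2 = 3 / 2 by norm_num, ha,
        div_mul_cancel₀ _ (pow_ne_zero _ (by norm_num)), sub_self] at h
      exact h.congr fun τ => (hFa τ).symm
    obtain ⟨g, hg⟩ := exists_eq_e₁_sub_two_mul_e₂_mul F hF0
    obtain ⟨c, hc⟩ := ih (ModularForm.mcast (by push_cast; ring) g)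
    refine ⟨fun i => if i = m + 1 then a else c i, fun τ => ?_⟩
    have h := hg τ
    rw [hFa, sub_eq_iff_eq_add] at h
    have hc' : g τ = _ := hc τ
    rw [h, hc', Finset.sum_range_succ _ (m + 1), Finset.mul_sum]
    simp only [if_true, Nat.sub_self, pow_zero, mul_one]
    congr 1
    refine Finset.sum_congr rfl fun i hi => ?_
    have hi' := Finset.mem_range.mp hi
    rw [if_neg (by omega), show m + 1 - i = m - i + 1 by omega, pow_succ]
    ring

/-! ### Restriction of a form in two variables to one variable -/

/-- For fixed `τ₂`, a modular form for `G` is a modular form for `Γ(2)` in its first variable. A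
translate of it by `γ` is, up to a constant, the restriction at `γ⁻¹ τ₂`, and thus bounded. -/
theorem IsModularForm.exists_slice {k : ℤ} {f : ℍ × ℍ → ℂ} (hf : IsModularForm k f) (τ₂ : ℍ) :
    ∃ g : PrincipalForm k, ∀ z, g z = f (z, τ₂) := by
  refine ⟨modularFormOfSlash (Gamma 2) (fun z => f (z, τ₂)) ?_ (fun γ hγ => ?_) fun γ => ?_,
    fun z => rfl⟩
  · rw [mdifferentiable_iff]
    have h : DifferentiableOn ℂ ((fun z : ℂ × ℂ => f (ofComplex z.1, ofComplex z.2)) ∘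
        fun z : ℂ => (z, (τ₂ : ℂ))) {z | 0 < z.im} :=
      hf.holo.comp (by fun_prop) fun z hz => ⟨hz, τ₂.im_pos⟩
    exact h.congr fun z hz => by simp
  · refine slash_eq_of_apply_smul fun z => ?_
    have hM : ((γ, 1) : SL(2, ℤ) × SL(2, ℤ)) ∈ G := by
      change modTwo γ = modTwo 1
      rw [map_one]
      exact hγ
    simpa using hf.transform (γ, 1) hM z τ₂
  · have hM : ((γ, γ) : SL(2, ℤ) × SL(2, ℤ)) ∈ G := rfl
    obtain ⟨l, hl⟩ := hf.phi₁
    have e : (fun z => f (z, τ₂)) ∣[k] γ = fun z =>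
        ((γ 1 0 : ℂ) * (γ⁻¹ • τ₂ : ℍ) + (γ 1 1 : ℂ)) ^ k * f (z, γ⁻¹ • τ₂) := by
      refine slash_eq_of_apply_smul fun z => ?_
      have h := hf.transform (γ, γ) hM z (γ⁻¹ • τ₂)
      simp only [smul_inv_smul] at h
      rw [h, mul_assoc]
    rw [e]
    exact ((hl (γ⁻¹ • τ₂)).const_mul _).isBigO_one ℝ

theorem IsModularForm.eq_zero_of_neg {k : ℤ} (hk : k < 0) {f : ℍ × ℍ → ℂ}
    (hf : IsModularForm k f) : f = 0 := by
  ext ⟨z, τ⟩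
  obtain ⟨g, hg⟩ := hf.exists_slice τ
  rw [← hg, ModularForm.isZero_of_neg_weight hk g]
  rfl

/-- The element `(-1, 1)` of `G` forces forms of odd weight to vanish. -/
theorem IsModularForm.eq_zero_of_odd {k : ℤ} (hk : Odd k) {f : ℍ × ℍ → ℂ}
    (hf : IsModularForm k f) : f = 0 := by
  ext ⟨z, τ⟩
  have hM : ((-1, 1) : SL(2, ℤ) × SL(2, ℤ)) ∈ G := by
    change modTwo (-1) = modTwo 1
    decide
  have h := hf.transform (-1, 1) hM z τ
  simp only [ModularGroup.SL_neg_smul, one_smul] at h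
  simp [hk.neg_one_zpow] at h
  exact self_eq_neg.mp h

/-- If all slices `f(·, y)` of a function of two variables lie in the span of finitely many
functions `g i`, then the coefficients can be chosen in any subspace containing the slices
`f(x, ·)`: the coefficient functionals are combinations of point evaluations. -/
theorem exists_sum_mul_of_mem_span {X Y ι : Type*} [Fintype ι] (g : ι → X → ℂ) (f : X → Y → ℂ)
    (W : Submodule ℂ (Y → ℂ)) (h₁ : ∀ y, (fun x => f x y) ∈ Submodule.span ℂ (Set.range g))
    (h₂ : ∀ x, f x ∈ W) :
    ∃ c : ι → Y → ℂ, (∀ i, c i ∈ W) ∧ ∀ x y, f x y = ∑ i, c i y * g i x := by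
  set V := Submodule.span ℂ (Set.range g) with hV
  have : FiniteDimensional ℂ V := FiniteDimensional.span_of_finite ℂ (Set.finite_range g)
  let ev (x : X) : Module.Dual ℂ V := (LinearMap.proj x).comp V.subtype
  -- the point evaluations separate the elements of `V`, so they span its dual
  have hspan : Submodule.span ℂ (Set.range ev) = ⊤ := by
    refine Submodule.span_eq_top_of_ne_zero fun v hv => ?_
    by_contra! h
    refine hv (Subtype.ext (funext fun x => ?_))
    exact h _ ⟨x, rfl⟩
  have hW (φ : Module.Dual ℂ V) : (fun y => φ ⟨_, h₁ y⟩) ∈ W := by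
    have hφ : φ ∈ Submodule.span ℂ (Set.range ev) := hspan ▸ Submodule.mem_top
    induction hφ using Submodule.span_induction with
    | mem φ h => obtain ⟨x, rfl⟩ := h; exact h₂ x
    | zero => exact W.zero_mem
    | add φ ψ _ _ h h' => exact W.add_mem h h'
    | smul a φ _ h => exact W.smul_mem a h
  have hgV (i : ι) : g i ∈ V := Submodule.subset_span ⟨i, rfl⟩
  let p : (ι → ℂ) →ₗ[ℂ] V := Fintype.linearCombination ℂ fun i => (⟨g i, hgV i⟩ : V)
  have hp : LinearMap.range p = ⊤ := by
    rw [Fintype.range_linearCombination, eq_top_iff]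
    rintro ⟨v, hv⟩ -
    have h : Submodule.map V.subtype
        (Submodule.span ℂ (Set.range fun i => (⟨g i, hgV i⟩ : V))) = V := by
      rw [Submodule.map_span, ← Set.range_comp]
      rfl
    have hv' := hv
    rw [← h] at hv'
    obtain ⟨w, hw, hwv⟩ := hv'
    have : w = ⟨v, hv⟩ := Subtype.ext hwv
    exact this ▸ hw
  obtain ⟨s, hs⟩ := p.exists_rightInverse_of_surjective hp
  refine ⟨fun i y => s ⟨_, h₁ y⟩ i, fun i => hW ((LinearMap.proj i).comp s), fun x y => ?_⟩
  have h := congrArg (fun v : V => (v : X → ℂ) x) (LinearMap.congr_fun hs ⟨_, h₁ y⟩)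
  simp only [p, LinearMap.comp_apply, Fintype.linearCombination_apply, LinearMap.id_apply] at h
  rw [← h]
  simp

/-- A symmetric modular form of weight `2 m` for `G` is a bihomogeneous polynomial of bidegree
`(m, m)` in the values of `e₁ + e₂` and `e₁ - 2 e₂` at the two variables. -/
theorem exists_eq_double_sum {m : ℕ} {f : ℍ × ℍ → ℂ} (hf : f ∈ symForms (2 * m)) :
    ∃ C : Fin (m + 1) → Fin (m + 1) → ℂ, ∀ τ : ℍ × ℍ, f τ = ∑ i, ∑ j, C i j *
      (((e₁ τ.1 + e₂ τ.1) ^ (i : ℕ) * (e₁ τ.1 - 2 * e₂ τ.1) ^ (m - i)) *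
        ((e₁ τ.2 + e₂ τ.2) ^ (j : ℕ) * (e₁ τ.2 - 2 * e₂ τ.2) ^ (m - j))) := by
  set g : Fin (m + 1) → ℍ → ℂ :=
    fun i τ => (e₁ τ + e₂ τ) ^ (i : ℕ) * (e₁ τ - 2 * e₂ τ) ^ (m - i) with hg
  have h₁ (y : ℍ) : (fun x => f (x, y)) ∈ Submodule.span ℂ (Set.range g) := by
    obtain ⟨F, hF⟩ := hf.1.exists_slice y
    obtain ⟨c, hc⟩ := F.exists_eq_sum m
    have e : (fun x => f (x, y)) = ∑ i : Fin (m + 1), c i • g i := by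
      ext x
      rw [← hF, hc, Finset.sum_range]
      simp [hg, mul_assoc]
    rw [e]
    exact Submodule.sum_mem _ fun i _ =>
      Submodule.smul_mem _ _ (Submodule.subset_span ⟨i, rfl⟩)
  have h₂ (x : ℍ) : (fun y => f (x, y)) ∈ Submodule.span ℂ (Set.range g) := by
    have e : (fun y => f (x, y)) = fun y => f (y, x) := funext fun y => hf.2 x y
    rw [e]
    exact h₁ x
  obtain ⟨c, hcW, hc⟩ := exists_sum_mul_of_mem_span g (fun x y => f (x, y)) _ h₁ h₂
  choose C hC using fun i => (Submodule.mem_span_range_iff_exists_fun ℂ).mp (hcW i)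
  refine ⟨C, fun τ => ?_⟩
  rw [show f τ = f (τ.1, τ.2) from rfl, hc]
  refine Finset.sum_congr rfl fun i _ => ?_
  rw [← hC, Finset.sum_apply, Finset.sum_mul]
  refine Finset.sum_congr rfl fun j _ => ?_
  simp only [Pi.smul_apply, smul_eq_mul, hg]
  ring

/-! ### The three products of linear forms -/

/-- The products `ℓ(τ₁) ℓ(τ₂)` for the three linear forms `ℓ = e₁ + e₂, e₁ - 2 e₂, 2 e₁ - e₂`,
which `SL₂(ℤ)` permutes up to sign. -/
def lineProducts (τ : ℍ × ℍ) : Fin 3 → ℂ :=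
  ![(e₁ τ.1 + e₂ τ.1) * (e₁ τ.2 + e₂ τ.2),
    (e₁ τ.1 - 2 * e₂ τ.1) * (e₁ τ.2 - 2 * e₂ τ.2),
    (2 * e₁ τ.1 - e₂ τ.1) * (2 * e₁ τ.2 - e₂ τ.2)]

/-! ### Algebraic independence of the products -/

open Polynomial in
theorem eval_comp_eq_zero_of_infinite {σ : Type*} (Q : MvPolynomial σ ℂ) (a : σ → ℂ[X])
    {s : Set ℂ} (hs : s.Infinite)
    (h : ∀ t ∈ s, MvPolynomial.eval (fun i => (a i).eval t) Q = 0) (t : ℂ) :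
    MvPolynomial.eval (fun i => (a i).eval t) Q = 0 := by
  have key (t : ℂ) : (MvPolynomial.aeval a Q).eval t =
      MvPolynomial.eval (fun i => (a i).eval t) Q := by
    rw [MvPolynomial.aeval_def, ← coe_evalRingHom, MvPolynomial.hom_eval₂]
    simp only [MvPolynomial.eval, coe_evalRingHom]
    congr 1
    ext x
    simp
  have hQ : MvPolynomial.aeval a Q = 0 :=
    Polynomial.eq_zero_of_infinite_isRoot _ (hs.mono fun t ht => by
      simpa [Polynomial.IsRoot, key] using h t ht)
  rw [← key, hQ, eval_zero]

/-- The quotient `(e₁ - 2 e₂) / (e₁ + e₂)`, in effect the modular function `λ`, takes infinitely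
many values: it is continuous, never zero, and tends to zero at `i∞`. -/
theorem infinite_range_quotient :
    (Set.range fun τ => (e₁ τ - 2 * e₂ τ) / (e₁ τ + e₂ τ)).Infinite := by
  have h1 := mdifferentiable_e₁.continuous
  have h2 := mdifferentiable_e₂.continuous
  have hcont : Continuous fun τ => (e₁ τ - 2 * e₂ τ) / (e₁ τ + e₂ τ) :=
    (h1.sub (continuous_const.mul h2)).div (h1.add h2) e₁_add_e₂_ne_zero
  refine (isPreconnected_range hcont).infinite_of_nontrivial ?_
  by_contra hn
  rw [Set.not_nontrivial_iff] at hn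
  have hlim : Tendsto (fun τ => (e₁ τ - 2 * e₂ τ) / (e₁ τ + e₂ τ)) atImInfty (𝓝 0) := by
    have h := (tendsto_e₁.sub (tendsto_e₂.const_mul 2)).div (tendsto_e₁.add tendsto_e₂)
      (by norm_num)
    norm_num at h
    exact h
  have hc : (fun τ => (e₁ τ - 2 * e₂ τ) / (e₁ τ + e₂ τ)) =
      fun _ => (e₁ I - 2 * e₂ I) / (e₁ I + e₂ I) :=
    funext fun τ => hn ⟨τ, rfl⟩ ⟨I, rfl⟩
  rw [hc] at hlim
  exact div_ne_zero (e₁_sub_two_mul_e₂_ne_zero I) (e₁_add_e₂_ne_zero I)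
    (tendsto_nhds_unique tendsto_const_nhds hlim)

/-- The matrix `(1, 0; 2 n, 1)` of `Γ(2)`. -/
def lowerTwo (n : ℕ) : SL(2, ℤ) := ⟨!![1, 0; 2 * n, 1], by simp⟩

theorem lowerTwo_mem (n : ℕ) : lowerTwo n ∈ Gamma 2 := by
  have h : (2 : ZMod 2) = 0 := rfl
  rw [Gamma_mem]
  simp [lowerTwo, h]

theorem lowerTwo_one_mem_G (n : ℕ) : ((lowerTwo n, 1) : SL(2, ℤ) × SL(2, ℤ)) ∈ G := by
  change modTwo (lowerTwo n) = modTwo 1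
  rw [map_one]
  exact lowerTwo_mem n

theorem lowerTwo_factor (n : ℕ) (τ : ℍ) :
    ((lowerTwo n) 1 0 : ℂ) * τ + ((lowerTwo n) 1 1 : ℂ) = 2 * n * τ + 1 := by
  simp [lowerTwo]

/-- The automorphy factors of `Γ(2)` at a given point take infinitely many values; this is what
separates the weights. -/
theorem infinite_range_factor (τ : ℍ) : (Set.range fun n : ℕ => 2 * (n : ℂ) * τ + 1).Infinite := by
  refine Set.infinite_range_of_injective fun a b h => ?_
  have h0 := ne_zero τ
  simpa [h0] using h

theorem infinite_range_factor_sq (τ : ℍ) :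
    (Set.range fun n : ℕ => (2 * (n : ℂ) * τ + 1) ^ 2).Infinite := by
  intro hfin
  refine infinite_range_factor τ ?_
  have h : (Set.range fun n : ℕ => 2 * (n : ℂ) * τ + 1) ⊆
      (fun z : ℂ => z ^ 2) ⁻¹' Set.range fun n : ℕ => (2 * (n : ℂ) * τ + 1) ^ 2 := by
    rintro _ ⟨n, rfl⟩
    exact ⟨n, rfl⟩
  refine (Set.Finite.preimage' hfin fun b _ => ?_).subset h
  have hb : (fun z : ℂ => z ^ 2) ⁻¹' {b} ⊆ ((Polynomial.nthRoots 2 b).toFinset : Set ℂ) := by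
    intro z hz
    simpa [Polynomial.mem_nthRoots] using hz
  exact (Finset.finite_toSet _).subset hb

/-- The values of the three products are Zariski dense in affine space. The first variable can be
rescaled by an automorphy factor, so one may divide by the first product; the other two then become
`w₁ w₂` and `(1 + w₁) (1 + w₂)` with `w₁`, `w₂` in an infinite set, and over `ℂ` the sum and
product of two numbers are arbitrary. -/
theorem eq_zero_of_forall_eval_lineProducts (Q : MvPolynomial (Fin 3) ℂ)
    (h : ∀ τ, MvPolynomial.eval (lineProducts τ) Q = 0) : Q = 0 := by
  set w : ℍ → ℂ := fun τ => (e₁ τ - 2 * e₂ τ) / (e₁ τ + e₂ τ) with hw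
  have hscale (τ₁ τ₂ : ℍ) (t : ℂ) :
      MvPolynomial.eval (fun i => lineProducts (τ₁, τ₂) i * t) Q = 0 := by
    have H := eval_comp_eq_zero_of_infinite Q
      (fun i => Polynomial.C (lineProducts (τ₁, τ₂) i) * Polynomial.X)
      (infinite_range_factor_sq τ₁) ?_ t
    · simpa using H
    · rintro _ ⟨n, rfl⟩
      have h1 := apply_smul_of_slash (e₁_slash_of_mem_Gamma_two (lowerTwo_mem n)) τ₁
      have h2 := apply_smul_of_slash (e₂_slash_of_mem_Gamma_two (lowerTwo_mem n)) τ₁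
      rw [lowerTwo_factor, zpow_ofNat] at h1 h2
      rw [← h (lowerTwo n • τ₁, τ₂)]
      simp only [lineProducts, h1, h2]
      congr 2
      ext i
      fin_cases i <;> simp <;> ring
  have hww (t : ℂ) (τ₁ τ₂ : ℍ) :
      MvPolynomial.eval ![t, t * (w τ₁ * w τ₂), t * ((1 + w τ₁) * (1 + w τ₂))] Q = 0 := by
    have h1 := e₁_add_e₂_ne_zero τ₁
    have h2 := e₁_add_e₂_ne_zero τ₂
    rw [← hscale τ₁ τ₂ (t / ((e₁ τ₁ + e₂ τ₁) * (e₁ τ₂ + e₂ τ₂)))]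
    congr 2
    ext i
    fin_cases i <;> simp [lineProducts, hw] <;> field_simp
    ring
  have hw1 (t : ℂ) (τ₁ : ℍ) (y : ℂ) :
      MvPolynomial.eval ![t, t * (w τ₁ * y), t * ((1 + w τ₁) * (1 + y))] Q = 0 := by
    have H := eval_comp_eq_zero_of_infinite Q
      ![Polynomial.C t, Polynomial.C (t * w τ₁) * Polynomial.X,
        Polynomial.C (t * (1 + w τ₁)) * (1 + Polynomial.X)] infinite_range_quotient ?_ y
    · rw [← H]
      congr 2
      ext i
      fin_cases i <;> simp <;> ring
    · rintro _ ⟨τ₂, rfl⟩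
      rw [← hww t τ₁ τ₂]
      congr 2
      ext i
      fin_cases i <;> simp [hw] <;> ring
  have hw2 (t x y : ℂ) :
      MvPolynomial.eval ![t, t * (x * y), t * ((1 + x) * (1 + y))] Q = 0 := by
    have H := eval_comp_eq_zero_of_infinite Q
      ![Polynomial.C t, Polynomial.C (t * y) * Polynomial.X,
        Polynomial.C (t * (1 + y)) * (1 + Polynomial.X)] infinite_range_quotient ?_ x
    · rw [← H]
      congr 2
      ext i
      fin_cases i <;> simp <;> ring
    · rintro _ ⟨τ₁, rfl⟩
      rw [← hw1 t τ₁ y]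
      congr 2
      ext i
      fin_cases i <;> simp [hw] <;> ring
  refine MvPolynomial.funext_set (fun i => if i = 0 then {0}ᶜ else Set.univ) (fun i => ?_) ?_
  · split_ifs
    · exact (Set.finite_singleton 0).infinite_compl
    · exact Set.infinite_univ
  · intro x hx
    have hx0 : x 0 ≠ 0 := by simpa using hx 0 (Set.mem_univ _)
    -- `a`, `b` are the two numbers with product `x 1 / x 0` and `(1 + a) (1 + b) = x 2 / x 0`
    set p := x 1 / x 0 with hp
    set s := x 2 / x 0 - 1 - p with hs
    obtain ⟨r, hr⟩ := IsAlgClosed.exists_pow_nat_eq (s ^ 2 - 4 * p) two_pos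
    rw [map_zero, ← hw2 (x 0) ((s + r) / 2) ((s - r) / 2)]
    have e1 : (s + r) / 2 * ((s - r) / 2) = p := by linear_combination -hr / 4
    have e2 : (1 + (s + r) / 2) * (1 + (s - r) / 2) = x 2 / x 0 := by
      linear_combination -hr / 4 + hs
    rw [e1, e2]
    congr 2
    ext i
    fin_cases i <;> simp [hp] <;> field_simp

/-! ### Symmetric forms as symmetric polynomials -/

section Symmetrization

open MvPolynomial

/-- Power sums of two quantities are polynomials in their sum and product; here the sum
`u w' + u' w` is the third argument minus the first two, and the product is that of the first
two. -/
theorem exists_isHomogeneous_pow_add_pow (n : ℕ) :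
    ∃ Q : MvPolynomial (Fin 3) ℂ, Q.IsHomogeneous n ∧ ∀ u w u' w' : ℂ,
      eval ![u * u', w * w', (u + w) * (u' + w')] Q = (u * w') ^ n + (u' * w) ^ n := by
  induction n using Nat.strong_induction_on with
  | _ n ih =>
    match n, ih with
    | 0, _ => exact ⟨C 2, isHomogeneous_C _ _, fun u w u' w' => by simp; norm_num⟩
    | 1, _ =>
      refine ⟨X 2 - X 0 - X 1, ((isHomogeneous_X _ _).sub (isHomogeneous_X _ _)).sub
        (isHomogeneous_X _ _), fun u w u' w' => ?_⟩
      simp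
      ring
    | n + 2, ih =>
      obtain ⟨Q, hQ, hQe⟩ := ih n (by omega)
      obtain ⟨R, hR, hRe⟩ := ih (n + 1) (by omega)
      refine ⟨(X 2 - X 0 - X 1) * R - X 0 * X 1 * Q, ?_, fun u w u' w' => ?_⟩
      · refine IsHomogeneous.sub ?_ ?_
        · rw [show n + 2 = 1 + (n + 1) by ring]
          exact (((isHomogeneous_X _ _).sub (isHomogeneous_X _ _)).sub
            (isHomogeneous_X _ _)).mul hR
        · rw [show n + 2 = 1 + 1 + n by ring]
          exact ((isHomogeneous_X _ _).mul (isHomogeneous_X _ _)).mul hQ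
      · simp only [map_sub, map_mul, eval_X, hQe, hRe]
        simp
        ring

/-- A bihomogeneous monomial of bidegree `(m, m)`, symmetrized under the exchange of `(u, w)` and
`(u', w')`, is a common factor `(u u')^i (w w')^(m - j)` times a sum of two `(j - i)`-th powers. -/
theorem exists_isHomogeneous_symmetrized {m i j : ℕ} (hi : i ≤ m) (hj : j ≤ m) :
    ∃ Q : MvPolynomial (Fin 3) ℂ, Q.IsHomogeneous m ∧ ∀ u w u' w' : ℂ,
      eval ![u * u', w * w', (u + w) * (u' + w')] Q =
        (u ^ i * w ^ (m - i)) * (u' ^ j * w' ^ (m - j)) +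
          (u' ^ i * w' ^ (m - i)) * (u ^ j * w ^ (m - j)) := by
  wlog hij : i ≤ j generalizing i j
  · obtain ⟨Q, hQ, hQe⟩ := this hj hi (le_of_not_ge hij)
    refine ⟨Q, hQ, fun u w u' w' => ?_⟩
    rw [hQe]
    ring
  obtain ⟨Q, hQ, hQe⟩ := exists_isHomogeneous_pow_add_pow (j - i)
  refine ⟨X 0 ^ i * X 1 ^ (m - j) * Q, ?_, fun u w u' w' => ?_⟩
  · have h := ((isHomogeneous_X_pow (R := ℂ) (0 : Fin 3) i).mul
      (isHomogeneous_X_pow (1 : Fin 3) (m - j))).mul hQ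
    rwa [show i + (m - j) + (j - i) = m by omega] at h
  · simp only [map_mul, map_pow, eval_X, hQe]
    obtain ⟨k, rfl⟩ := Nat.exists_eq_add_of_le hij
    obtain ⟨l, rfl⟩ := Nat.exists_eq_add_of_le hj
    rw [show i + k - i = k by omega, show i + k + l - (i + k) = l by omega,
      show i + k + l - i = k + l by omega]
    simp
    ring

theorem exists_isHomogeneous_eval_lineProducts {m : ℕ} {f : ℍ × ℍ → ℂ}
    (hf : f ∈ symForms (2 * m)) : ∃ Q : MvPolynomial (Fin 3) ℂ, Q.IsHomogeneous m ∧
      ∀ τ, f τ = eval (lineProducts τ) Q := by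
  obtain ⟨C', hC⟩ := exists_eq_double_sum hf
  choose Q hQ hQe using fun i j : Fin (m + 1) =>
    exists_isHomogeneous_symmetrized (Nat.lt_succ_iff.mp i.2) (Nat.lt_succ_iff.mp j.2)
  refine ⟨∑ i, ∑ j, C (C' i j / 2) * Q i j, ?_, fun τ => ?_⟩
  · refine IsHomogeneous.sum _ _ _ fun i _ => IsHomogeneous.sum _ _ _ fun j _ => ?_
    have h := (isHomogeneous_C (Fin 3) (C' i j / 2)).mul (hQ i j)
    rwa [zero_add] at h
  · have hL : lineProducts τ = ![(e₁ τ.1 + e₂ τ.1) * (e₁ τ.2 + e₂ τ.2),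
        (e₁ τ.1 - 2 * e₂ τ.1) * (e₁ τ.2 - 2 * e₂ τ.2),
        ((e₁ τ.1 + e₂ τ.1) + (e₁ τ.1 - 2 * e₂ τ.1)) *
          ((e₁ τ.2 + e₂ τ.2) + (e₁ τ.2 - 2 * e₂ τ.2))] := by
      ext i
      fin_cases i <;> simp [lineProducts]
      ring
    -- average the two expressions for `f` that result from exchanging the variables
    have h1 := hC τ
    have h2 := hC (τ.2, τ.1)
    have h3 : f τ = f (τ.2, τ.1) := hf.2 τ.1 τ.2
    have h4 : f τ = (f τ + f (τ.2, τ.1)) / 2 := by rw [← h3]; ring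
    rw [h4, h1, h2, ← Finset.sum_add_distrib, Finset.sum_div, map_sum]
    refine Finset.sum_congr rfl fun i _ => ?_
    rw [← Finset.sum_add_distrib, Finset.sum_div, map_sum]
    refine Finset.sum_congr rfl fun j _ => ?_
    rw [map_mul, eval_C, hL, hQe]
    ring

theorem isSymmetric_of_rename_swap {Q : MvPolynomial (Fin 3) ℂ}
    (h₁ : rename (Equiv.swap (0 : Fin 3) 2) Q = Q)
    (h₂ : rename (Equiv.swap (1 : Fin 3) 2) Q = Q) : Q.IsSymmetric := by
  have key : ∀ e : Equiv.Perm (Fin 3), e = 1 ∨ e = Equiv.swap 0 2 ∨ e = Equiv.swap 1 2 ∨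
      e = Equiv.swap 0 2 * Equiv.swap 1 2 ∨ e = Equiv.swap 1 2 * Equiv.swap 0 2 ∨
      e = Equiv.swap 0 2 * (Equiv.swap 1 2 * Equiv.swap 0 2) := by decide
  have hmul {a b : Equiv.Perm (Fin 3)} (ha : rename a Q = Q) (hb : rename b Q = Q) :
      rename (a * b) Q = Q := by
    rw [Equiv.Perm.coe_mul, ← rename_rename, hb, ha]
  intro e
  rcases key e with rfl | rfl | rfl | rfl | rfl | rfl
  · simp
  · exact h₁
  · exact h₂
  · exact hmul h₁ h₂
  · exact hmul h₂ h₁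
  · exact hmul h₁ (hmul h₂ h₁)

theorem lineProducts_T (τ : ℍ × ℍ) :
    lineProducts (ModularGroup.T • τ.1, ModularGroup.T • τ.2) =
      lineProducts τ ∘ Equiv.swap (0 : Fin 3) 2 := by
  have hj (τ : ℍ) : (ModularGroup.T 1 0 : ℂ) * τ + (ModularGroup.T 1 1 : ℂ) = 1 := by
    simp [ModularGroup.T]
  have h1 (τ : ℍ) := apply_smul_of_slash e₁_slash_T τ
  have h2 (τ : ℍ) := apply_smul_of_slash e₂_slash_T τ
  simp only [e₃_eq, hj, one_zpow, one_mul, Pi.neg_apply, Pi.sub_apply] at h1 h2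
  simp only [lineProducts, h1, h2]
  ext i
  fin_cases i <;> simp [Equiv.swap_apply_of_ne_of_ne] <;> ring

theorem lineProducts_S (τ : ℍ × ℍ) :
    lineProducts (ModularGroup.S • τ.1, ModularGroup.S • τ.2) =
      ((τ.1 : ℂ) ^ 2 * (τ.2 : ℂ) ^ 2) • (lineProducts τ ∘ Equiv.swap (1 : Fin 3) 2) := by
  have hj (τ : ℍ) : (ModularGroup.S 1 0 : ℂ) * τ + (ModularGroup.S 1 1 : ℂ) = τ := by
    simp [ModularGroup.S]
  have h1 (τ : ℍ) := apply_smul_of_slash e₁_slash_S τ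
  have h2 (τ : ℍ) := apply_smul_of_slash e₂_slash_S τ
  simp only [hj, Pi.neg_apply, zpow_ofNat] at h1 h2
  simp only [lineProducts, h1, h2]
  ext i
  fin_cases i <;> simp [Equiv.swap_apply_of_ne_of_ne] <;> ring

theorem eval_smul_of_isHomogeneous {σ : Type*} {m : ℕ} {Q : MvPolynomial σ ℂ}
    (hQ : Q.IsHomogeneous m) (c : ℂ) (x : σ → ℂ) : eval (c • x) Q = c ^ m * eval x Q := by
  rw [eval_eq, eval_eq, Finset.mul_sum]
  refine Finset.sum_congr rfl fun d hd => ?_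
  have hdeg : ∑ i ∈ d.support, d i = m := by
    have h := hQ (mem_support_iff.mp hd)
    rwa [show (1 : σ → ℕ) = fun _ => 1 from rfl, ← Finsupp.degree_eq_weight_one,
      Finsupp.degree_apply] at h
  simp only [Pi.smul_apply, smul_eq_mul, mul_pow, Finset.prod_mul_distrib,
    Finset.prod_pow_eq_pow_sum, hdeg]
  ring

/-- Invariance of `f` under `(T, T)` and `(S, S)` makes the polynomial invariant under two
transpositions, because the products are algebraically independent. -/
theorem exists_isSymmetric_eval_lineProducts {m : ℕ} {f : ℍ × ℍ → ℂ}
    (hf : f ∈ symForms (2 * m)) : ∃ Q : MvPolynomial (Fin 3) ℂ, Q.IsSymmetric ∧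
      ∀ τ, f τ = eval (lineProducts τ) Q := by
  obtain ⟨Q, hQ, hfQ⟩ := exists_isHomogeneous_eval_lineProducts hf
  refine ⟨Q, isSymmetric_of_rename_swap ?_ ?_, hfQ⟩
  · refine sub_eq_zero.mp (eq_zero_of_forall_eval_lineProducts _ fun τ => ?_)
    have hj (τ : ℍ) : (ModularGroup.T 1 0 : ℂ) * τ + (ModularGroup.T 1 1 : ℂ) = 1 := by
      simp [ModularGroup.T]
    have hT : ((ModularGroup.T, ModularGroup.T) : SL(2, ℤ) × SL(2, ℤ)) ∈ G := rfl
    have h := hf.1.transform _ hT τ.1 τ.2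
    simp only [hj, one_zpow, one_mul] at h
    rw [hfQ, hfQ, lineProducts_T] at h
    rw [map_sub, eval_rename, h, sub_self]
  · refine sub_eq_zero.mp (eq_zero_of_forall_eval_lineProducts _ fun τ => ?_)
    have hj (τ : ℍ) : (ModularGroup.S 1 0 : ℂ) * τ + (ModularGroup.S 1 1 : ℂ) = τ := by
      simp [ModularGroup.S]
    have hS : ((ModularGroup.S, ModularGroup.S) : SL(2, ℤ) × SL(2, ℤ)) ∈ G := rfl
    have h := hf.1.transform _ hS τ.1 τ.2
    simp only [hj] at h
    rw [hfQ, hfQ, lineProducts_S, eval_smul_of_isHomogeneous hQ, ← mul_zpow, zpow_mul,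
      zpow_natCast, zpow_ofNat, mul_pow (τ.1 : ℂ)] at h
    have h0 : ((τ.1 : ℂ) ^ 2 * (τ.2 : ℂ) ^ 2) ^ m ≠ 0 :=
      pow_ne_zero _ (mul_ne_zero (pow_ne_zero _ (ne_zero τ.1)) (pow_ne_zero _ (ne_zero τ.2)))
    rw [map_sub, eval_rename, mul_left_cancel₀ h0 h, sub_self]

/-- The generators `X₂`, `X₄`, `Δ₆` as polynomials in the elementary symmetric functions of the
three products. -/
def generatorsOfEsymm : Fin 3 → MvPolynomial (Fin 3) ℂ :=
  ![C (2 / 9) * X 0, C (1 / 1296) * (X 0 ^ 2 - 4 * X 1), C (1 / 2916) * X 2]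

/-- The substitution inverse to `generatorsOfEsymm`. -/
def esymmOfGenerators : Fin 3 → MvPolynomial (Fin 3) ℂ :=
  ![C (9 / 2) * X 0, C (81 / 16) * X 0 ^ 2 - C 324 * X 1, C 2916 * X 2]

theorem eval_esymm_fin_three (x : Fin 3 → ℂ) :
    (fun i : Fin 3 => eval x (esymm (Fin 3) ℂ (i + 1))) =
      ![x 0 + x 1 + x 2, x 0 * x 1 + x 0 * x 2 + x 1 * x 2, x 0 * x 1 * x 2] := by
  ext i
  have h2 : Finset.powersetCard 2 (Finset.univ : Finset (Fin 3)) = {{0, 1}, {0, 2}, {1, 2}} := by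
    decide
  have h3 : Finset.powersetCard 3 (Finset.univ : Finset (Fin 3)) = {{0, 1, 2}} := by decide
  fin_cases i
  · simp [esymm_one, Fin.sum_univ_three]
  · simp only [esymm, Fin.mk_one, Nat.reduceAdd, h2]
    rw [Finset.sum_insert (by decide), Finset.sum_insert (by decide), Finset.sum_singleton]
    simp
    ring
  · simp [esymm, h3]
    ring

theorem eval_aeval_eq {σ ι : Type*} (A : ι → MvPolynomial σ ℂ) (P : MvPolynomial ι ℂ) (x : σ → ℂ) :
    eval x (aeval A P) = eval (fun i => eval x (A i)) P := by
  rw [aeval_def, hom_eval₂]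
  simp only [eval]
  congr 1
  ext y
  simp

theorem generators_eq_eval_esymm (τ : ℍ × ℍ) : ![X₂ τ, X₄ τ, Δ₆ τ] = fun i =>
    eval (fun j : Fin 3 => eval (lineProducts τ) (esymm (Fin 3) ℂ (j + 1)))
      (generatorsOfEsymm i) := by
  rw [eval_esymm_fin_three]
  ext i
  fin_cases i
  · simp [generatorsOfEsymm, lineProducts, X₂, f₁₁, f₁₂, f₂₁, f₂₂]
    ring
  · simp [generatorsOfEsymm, lineProducts, X₄, f₁₂, f₂₁]
    ring
  · simp [generatorsOfEsymm, lineProducts, Δ₆_eq, f₁₁, f₁₂, f₂₁, f₂₂]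
    ring

/-- `X₂`, `X₄`, `Δ₆` are algebraically independent as functions. -/
theorem eq_zero_of_forall_eval_generators (P : MvPolynomial (Fin 3) ℂ)
    (h : ∀ τ, eval ![X₂ τ, X₄ τ, Δ₆ τ] P = 0) : P = 0 := by
  have h1 : esymmAlgHom (Fin 3) ℂ 3 (aeval generatorsOfEsymm P) = 0 := by
    refine Subtype.ext (eq_zero_of_forall_eval_lineProducts _ fun τ => ?_)
    rw [esymmAlgHom_apply, eval_aeval_eq, eval_aeval_eq, ← generators_eq_eval_esymm]
    exact h τ
  have h2 : aeval generatorsOfEsymm P = 0 :=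
    esymmAlgHom_fin_injective ℂ le_rfl (h1.trans (map_zero _).symm)
  refine funext fun x => ?_
  rw [map_zero, ← map_zero (eval fun j => eval x (esymmOfGenerators j)), ← h2, eval_aeval_eq]
  congr 2
  ext i
  fin_cases i <;> simp [generatorsOfEsymm, esymmOfGenerators] <;> ring

/-- Every symmetric form is a polynomial in `X₂`, `X₄`, `Δ₆`, in each weight. -/
theorem exists_eval_generators {k : ℤ} {f : ℍ × ℍ → ℂ} (hf : f ∈ symForms k) :
    ∃ P : MvPolynomial (Fin 3) ℂ, ∀ τ, f τ = eval ![X₂ τ, X₄ τ, Δ₆ τ] P := by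
  rcases Int.even_or_odd k with hk | hk
  · rcases lt_or_ge k 0 with hneg | hpos
    · exact ⟨0, fun τ => by rw [hf.1.eq_zero_of_neg hneg]; simp⟩
    · obtain ⟨n, rfl⟩ := even_iff_two_dvd.mp hk
      obtain ⟨m, rfl⟩ := Int.eq_ofNat_of_zero_le (show 0 ≤ n by omega)
      obtain ⟨Q, hQ, hfQ⟩ := exists_isSymmetric_eval_lineProducts hf
      obtain ⟨R, hR⟩ := (esymmAlgHom_fin_bijective ℂ 3).2 ⟨Q, hQ⟩
      have hR' : aeval (fun i : Fin 3 => esymm (Fin 3) ℂ (i + 1)) R = Q := by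
        rw [← esymmAlgHom_apply, hR]
      refine ⟨aeval esymmOfGenerators R, fun τ => ?_⟩
      rw [hfQ, ← hR', eval_aeval_eq, eval_aeval_eq, generators_eq_eval_esymm]
      congr 2
      ext i
      fin_cases i <;> simp [generatorsOfEsymm, esymmOfGenerators] <;> ring
  · exact ⟨0, fun τ => by rw [hf.1.eq_zero_of_odd hk]; simp⟩

/-! ### From the graded ring to functions -/

/-- Forms of different weights are linearly independent: along `Γ(2) × 1` they are multiplied by
different powers of an automorphy factor that takes infinitely many values. -/
theorem coeAlgHom_symForms_injective :
    Function.Injective (DirectSum.coeAlgHom symForms : SymRing →ₐ[ℂ] (ℍ × ℍ → ℂ)) := by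
  classical
  rw [injective_iff_map_eq_zero]
  intro x hx
  have hneg (k : ℤ) (hk : k < 0) : x k = 0 := Subtype.ext ((x k).2.1.eq_zero_of_neg hk)
  have hsum : ∑ k ∈ DFinsupp.support x, (x k : ℍ × ℍ → ℂ) = 0 := by
    rw [← hx]
    conv_rhs => rw [← DirectSum.sum_support_of x]
    simp [DirectSum.coeAlgHom_of]
  have hpos {k : ℤ} (hk : k ∈ DFinsupp.support x) : 0 ≤ k := by
    by_contra h
    exact (DFinsupp.mem_support_iff.mp hk) (hneg k (not_le.mp h))
  ext k τ
  by_cases hk : k ∈ DFinsupp.support x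
  swap
  · rw [DFinsupp.notMem_support_iff.mp hk]
    rfl
  set p : Polynomial ℂ := ∑ l ∈ DFinsupp.support x,
    Polynomial.C ((x l : ℍ × ℍ → ℂ) τ) * Polynomial.X ^ l.toNat with hp
  have hp0 : p = 0 := by
    refine Polynomial.eq_zero_of_infinite_isRoot _ ((infinite_range_factor τ.1).mono ?_)
    rintro _ ⟨n, rfl⟩
    have h := congrFun hsum (lowerTwo n • τ.1, τ.2)
    rw [Finset.sum_apply] at h
    rw [Set.mem_ofPred_eq, Polynomial.IsRoot, hp, Polynomial.eval_finsetSum]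
    refine Eq.trans (Finset.sum_congr rfl fun l hl => ?_) h
    have ht := (x l).2.1.transform _ (lowerTwo_one_mem_G n) τ.1 τ.2
    simp only [lowerTwo_factor, one_smul] at ht
    rw [ht]
    lift l to ℕ using hpos hl
    simp
    ring
  have hc : p.coeff k.toNat = (x k : ℍ × ℍ → ℂ) τ := by
    rw [hp, Polynomial.finsetSum_coeff, Finset.sum_eq_single k]
    · simp
    · intro l hl hlk
      rw [Polynomial.coeff_C_mul, Polynomial.coeff_X_pow, if_neg, mul_zero]
      have := hpos hl
      have := hpos hk
      omega
    · exact fun h => absurd hk h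
  rw [← hc, hp0]
  simp

end Symmetrization

/-! ### The generators are modular forms -/

theorem isHolomorphic_mul {f g : ℍ → ℂ} (hf : MDiff f) (hg : MDiff g) :
    IsHolomorphic fun τ => f τ.1 * g τ.2 := by
  rw [mdifferentiable_iff] at hf hg
  exact (hf.comp differentiableOn_fst fun z hz => hz.1).mul
    (hg.comp differentiableOn_snd fun z hz => hz.2)

theorem isHolomorphic_f₁₁ : IsHolomorphic f₁₁ :=
  isHolomorphic_mul mdifferentiable_e₁ mdifferentiable_e₁

theorem isHolomorphic_f₁₂ : IsHolomorphic f₁₂ :=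
  isHolomorphic_mul mdifferentiable_e₁ mdifferentiable_e₂

theorem isHolomorphic_f₂₁ : IsHolomorphic f₂₁ :=
  isHolomorphic_mul mdifferentiable_e₂ mdifferentiable_e₁

theorem isHolomorphic_f₂₂ : IsHolomorphic f₂₂ :=
  isHolomorphic_mul mdifferentiable_e₂ mdifferentiable_e₂

/-- The two components of an element of `G` act on `(e₁, e₂)` through the same matrix. -/
theorem exists_divisionMatrix_of_mem_G {M : SL(2, ℤ) × SL(2, ℤ)} (hM : M ∈ G) (τ₁ τ₂ : ℍ) :
    ∃ a b c d : ℂ, IsDivisionMatrix a b c d ∧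
      e₁ (M.1 • τ₁) = ((M.1 1 0 : ℂ) * τ₁ + (M.1 1 1 : ℂ)) ^ 2 * (a * e₁ τ₁ + b * e₂ τ₁) ∧
      e₂ (M.1 • τ₁) = ((M.1 1 0 : ℂ) * τ₁ + (M.1 1 1 : ℂ)) ^ 2 * (c * e₁ τ₁ + d * e₂ τ₁) ∧
      e₁ (M.2 • τ₂) = ((M.2 1 0 : ℂ) * τ₂ + (M.2 1 1 : ℂ)) ^ 2 * (a * e₁ τ₂ + b * e₂ τ₂) ∧
      e₂ (M.2 • τ₂) = ((M.2 1 0 : ℂ) * τ₂ + (M.2 1 1 : ℂ)) ^ 2 * (c * e₁ τ₂ + d * e₂ τ₂) := by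
  obtain ⟨a, b, c, d, h, -, hγ⟩ := exists_divisionMatrix (modTwo M.1)
  have hM' : modTwo M.2 = modTwo M.1 := hM.symm
  exact ⟨a, b, c, d, h, apply_smul_of_slash (hγ _ rfl).1 τ₁, apply_smul_of_slash (hγ _ rfl).2 τ₁,
    apply_smul_of_slash (hγ _ hM').1 τ₂, apply_smul_of_slash (hγ _ hM').2 τ₂⟩

theorem X₂_transform {M : SL(2, ℤ) × SL(2, ℤ)} (hM : M ∈ G) (τ₁ τ₂ : ℍ) :
    X₂ (M.1 • τ₁, M.2 • τ₂) = ((M.1 1 0 : ℂ) * τ₁ + (M.1 1 1 : ℂ)) ^ (2 : ℤ) *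
      ((M.2 1 0 : ℂ) * τ₂ + (M.2 1 1 : ℂ)) ^ (2 : ℤ) * X₂ (τ₁, τ₂) := by
  obtain ⟨a, b, c, d, h, h1, h2, h3, h4⟩ := exists_divisionMatrix_of_mem_G hM τ₁ τ₂
  simp only [X₂, f₁₁, f₁₂, f₂₁, f₂₂, h1, h2, h3, h4, zpow_ofNat]
  rcases h with h | h | h | h | h | h <;> obtain ⟨rfl, rfl, rfl, rfl⟩ := h <;> ring

theorem X₄_transform {M : SL(2, ℤ) × SL(2, ℤ)} (hM : M ∈ G) (τ₁ τ₂ : ℍ) :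
    X₄ (M.1 • τ₁, M.2 • τ₂) = ((M.1 1 0 : ℂ) * τ₁ + (M.1 1 1 : ℂ)) ^ (4 : ℤ) *
      ((M.2 1 0 : ℂ) * τ₂ + (M.2 1 1 : ℂ)) ^ (4 : ℤ) * X₄ (τ₁, τ₂) := by
  obtain ⟨a, b, c, d, h, h1, h2, h3, h4⟩ := exists_divisionMatrix_of_mem_G hM τ₁ τ₂
  simp only [X₄, f₁₂, f₂₁, h1, h2, h3, h4, zpow_ofNat]
  generalize (M.1 1 0 : ℂ) * τ₁ + (M.1 1 1 : ℂ) = j₁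
  generalize (M.2 1 0 : ℂ) * τ₂ + (M.2 1 1 : ℂ) = j₂
  rcases h with h | h | h | h | h | h <;> obtain ⟨rfl, rfl, rfl, rfl⟩ := h <;> ring

theorem Δ₆_transform {M : SL(2, ℤ) × SL(2, ℤ)} (hM : M ∈ G) (τ₁ τ₂ : ℍ) :
    Δ₆ (M.1 • τ₁, M.2 • τ₂) = ((M.1 1 0 : ℂ) * τ₁ + (M.1 1 1 : ℂ)) ^ (6 : ℤ) *
      ((M.2 1 0 : ℂ) * τ₂ + (M.2 1 1 : ℂ)) ^ (6 : ℤ) * Δ₆ (τ₁, τ₂) := by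
  obtain ⟨a, b, c, d, h, h1, h2, h3, h4⟩ := exists_divisionMatrix_of_mem_G hM τ₁ τ₂
  simp only [Δ₆_eq, f₁₁, f₁₂, f₂₁, f₂₂, h1, h2, h3, h4, zpow_ofNat]
  generalize (M.1 1 0 : ℂ) * τ₁ + (M.1 1 1 : ℂ) = j₁
  generalize (M.2 1 0 : ℂ) * τ₂ + (M.2 1 1 : ℂ) = j₂
  rcases h with h | h | h | h | h | h <;> obtain ⟨rfl, rfl, rfl, rfl⟩ := h <;> ring

theorem e₁_slash_of_mem_Gamma0 {γ : SL(2, ℤ)} (hγ : γ ∈ Gamma0 2) : e₁ ∣[(2 : ℤ)] γ = e₁ := by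
  rcases mem_Gamma_two_or_mul_T_inv_mem (γ := γ) hγ with h | h
  · exact e₁_slash_of_mem_Gamma_two h
  · rw [← inv_mul_cancel_right γ ModularGroup.T, SlashAction.slash_mul,
      e₁_slash_of_mem_Gamma_two h, e₁_slash_T]

theorem e₁_sub_two_mul_e₂_slash_of_mem_Gamma0 {γ : SL(2, ℤ)} (hγ : γ ∈ Gamma0 2) :
    ((e₁ - (2 : ℂ) • e₂) * (e₁ - (2 : ℂ) • e₂)) ∣[(4 : ℤ)] γ =
      (e₁ - (2 : ℂ) • e₂) * (e₁ - (2 : ℂ) • e₂) := by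
  have h : (e₁ - (2 : ℂ) • e₂) ∣[(2 : ℤ)] γ = e₁ - (2 : ℂ) • e₂ ∨
      (e₁ - (2 : ℂ) • e₂) ∣[(2 : ℤ)] γ = -(e₁ - (2 : ℂ) • e₂) := by
    rcases mem_Gamma_two_or_mul_T_inv_mem (γ := γ) hγ with h | h
    · left
      rw [sub_slash_SL, SL_smul_slash, e₁_slash_of_mem_Gamma_two h, e₂_slash_of_mem_Gamma_two h]
    · right
      rw [← inv_mul_cancel_right γ ModularGroup.T, SlashAction.slash_mul, sub_slash_SL,
        SL_smul_slash, e₁_slash_of_mem_Gamma_two h, e₂_slash_of_mem_Gamma_two h, sub_slash_SL,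
        SL_smul_slash, e₁_slash_T, e₂_slash_T, e₃_eq]
      module
  rw [show (4 : ℤ) = 2 + 2 by norm_num, mul_slash_SL2]
  rcases h with h | h <;> rw [h]
  rw [neg_mul_neg]

/-- `Φ X₂ = e₁`, as a modular form for `Γ₀(2)`. -/
def phiX₂ : LevelTwoForm 2 :=
  modularFormOfSlash (Gamma0 2) e₁ mdifferentiable_e₁ (fun _ => e₁_slash_of_mem_Gamma0)
    isBoundedAtImInfty_e₁_slash

/-- `Φ X₄ = (e₁ - 2 e₂)² / 576`, as a modular form for `Γ₀(2)`. -/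
def phiX₄ : LevelTwoForm 4 :=
  (1 / 576 : ℂ) • modularFormOfSlash (Gamma0 2) ((e₁ - (2 : ℂ) • e₂) * (e₁ - (2 : ℂ) • e₂))
    ((mdifferentiable_e₁.sub (mdifferentiable_e₂.const_smul 2)).mul
      (mdifferentiable_e₁.sub (mdifferentiable_e₂.const_smul 2)))
    (fun _ => e₁_sub_two_mul_e₂_slash_of_mem_Gamma0) (fun γ => by
      have h : IsBoundedAtImInfty ((e₁ - (2 : ℂ) • e₂) ∣[(2 : ℤ)] γ) := by
        rw [sub_slash_SL, SL_smul_slash]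
        exact (isBoundedAtImInfty_e₁_slash γ).sub
          ((isBoundedAtImInfty_e₂_slash γ).const_smul_left 2)
      rw [show (4 : ℤ) = 2 + 2 by norm_num, mul_slash_SL2]
      exact h.mul h)

theorem X₂_symm (τ₁ τ₂ : ℍ) : X₂ (τ₁, τ₂) = X₂ (τ₂, τ₁) := by
  simp only [X₂, f₁₁, f₁₂, f₂₁, f₂₂]
  ring

theorem X₄_symm (τ₁ τ₂ : ℍ) : X₄ (τ₁, τ₂) = X₄ (τ₂, τ₁) := by
  simp only [X₄, f₁₂, f₂₁]
  ring

theorem Δ₆_symm (τ₁ τ₂ : ℍ) : Δ₆ (τ₁, τ₂) = Δ₆ (τ₂, τ₁) :=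
  mul_comm _ _

theorem isPhi₁_X₂ : IsPhi₁ X₂ phiX₂ := fun τ => by
  have h := (((tendsto_e₁.mul_const (e₁ τ)).add (tendsto_e₂.mul_const (e₂ τ))).const_mul
    (4 / 3)).sub (((tendsto_e₁.mul_const (e₂ τ)).add (tendsto_e₂.mul_const (e₁ τ))).const_mul
    (2 / 3))
  refine h.trans (le_of_eq (congrArg 𝓝 ?_))
  change _ = e₁ τ
  ring

theorem isPhi₁_X₄ : IsPhi₁ X₄ phiX₄ := fun τ => by
  have h := (((tendsto_e₁.mul_const (e₂ τ)).sub (tendsto_e₂.mul_const (e₁ τ))).pow 2).const_mul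
    (1 / 144)
  refine h.trans (le_of_eq (congrArg 𝓝 ?_))
  change _ = 1 / 576 * ((e₁ τ - 2 * e₂ τ) * (e₁ τ - 2 * e₂ τ))
  ring

theorem isPhi₁_Δ₆ : IsPhi₁ Δ₆ 0 := fun τ => by
  have h := tendsto_etaPow_div.mul (qParam_tendsto_atImInfty two_pos)
  rw [mul_zero] at h
  have h' := h.mul_const (ModularForm.eta τ ^ 12)
  rw [zero_mul] at h'
  refine h'.congr fun z => ?_
  rw [div_mul_cancel₀ _ (by exact Complex.exp_ne_zero _)]
  rfl

theorem IsPhi₁.isPhi₂ {f : ℍ × ℍ → ℂ} {g : ℍ → ℂ} (h : IsPhi₁ f g)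
    (hf : ∀ τ₁ τ₂, f (τ₁, τ₂) = f (τ₂, τ₁)) : IsPhi₂ f g :=
  fun τ => (h τ).congr fun z => hf z τ

theorem X₂_mem : X₂ ∈ symForms 2 :=
  ⟨{ holo := ((isHolomorphic_f₁₁.add isHolomorphic_f₂₂).const_mul (4 / 3)).sub
       ((isHolomorphic_f₁₂.add isHolomorphic_f₂₁).const_mul (2 / 3))
     transform := fun _ => X₂_transform
     phi₁ := ⟨phiX₂, isPhi₁_X₂⟩
     phi₂ := ⟨phiX₂, isPhi₁_X₂.isPhi₂ X₂_symm⟩ }, X₂_symm⟩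

theorem X₄_mem : X₄ ∈ symForms 4 :=
  ⟨{ holo := ((isHolomorphic_f₁₂.sub isHolomorphic_f₂₁).pow 2).const_mul (1 / 144)
     transform := fun _ => X₄_transform
     phi₁ := ⟨phiX₄, isPhi₁_X₄⟩
     phi₂ := ⟨phiX₄, isPhi₁_X₄.isPhi₂ X₄_symm⟩ }, X₄_symm⟩

theorem isCuspForm_Δ₆ : IsCuspForm 6 Δ₆ where
  modular :=
    { holo := isHolomorphic_mul mdifferentiable_etaPow mdifferentiable_etaPow
      transform := fun _ => Δ₆_transform
      phi₁ := ⟨0, isPhi₁_Δ₆⟩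
      phi₂ := ⟨0, isPhi₁_Δ₆.isPhi₂ Δ₆_symm⟩ }
  phi₁_zero := isPhi₁_Δ₆
  phi₂_zero := isPhi₁_Δ₆.isPhi₂ Δ₆_symm

end DegenerateHilbert
end

open DegenerateHilbert
theorem mainTheorem6 :
    (∀ τ : ℍ × ℍ, Δ₆ τ = 1 / 2916 * (f₁₁ τ + f₁₂ τ + f₂₁ τ + f₂₂ τ) *
      (f₁₁ τ - 2 * f₁₂ τ - 2 * f₂₁ τ + 4 * f₂₂ τ) *
      (4 * f₁₁ τ - 2 * f₁₂ τ - 2 * f₂₁ τ + f₂₂ τ)) ∧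
    DegenerateHilbert.IsCuspForm 6 Δ₆ ∧
    ∃ (h₂ : X₂ ∈ symForms 2) (h₄ : X₄ ∈ symForms 4) (h₆ : Δ₆ ∈ symForms 6),
      Function.Bijective
        (MvPolynomial.aeval
          ![DirectSum.of (fun k : ℤ => symForms k) 2 ⟨X₂, h₂⟩,
            DirectSum.of (fun k : ℤ => symForms k) 4 ⟨X₄, h₄⟩,
            DirectSum.of (fun k : ℤ => symForms k) 6 ⟨Δ₆, h₆⟩] :
          MvPolynomial (Fin 3) ℂ →ₐ[ℂ] SymRing) := by
  refine ⟨Δ₆_eq, isCuspForm_Δ₆, X₂_mem, X₄_mem, ⟨isCuspForm_Δ₆.modular, Δ₆_symm⟩, ?_⟩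
  set Θ : MvPolynomial (Fin 3) ℂ →ₐ[ℂ] SymRing := MvPolynomial.aeval _ with hΘ
  have key (P : MvPolynomial (Fin 3) ℂ) (τ : ℍ × ℍ) :
      DirectSum.coeAlgHom symForms (Θ P) τ = MvPolynomial.eval ![X₂ τ, X₄ τ, Δ₆ τ] P := by
    have h : ((Pi.evalAlgHom ℂ (fun _ : ℍ × ℍ => ℂ) τ).comp
        ((DirectSum.coeAlgHom symForms).comp Θ)) = MvPolynomial.aeval ![X₂ τ, X₄ τ, Δ₆ τ] := by
      refine MvPolynomial.algHom_ext fun i => ?_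
      fin_cases i <;> simp [hΘ, DirectSum.coeAlgHom_of]
    exact DFunLike.congr_fun h P
  constructor
  · rw [injective_iff_map_eq_zero]
    intro P hP
    refine eq_zero_of_forall_eval_generators P fun τ => ?_
    rw [← key, hP, map_zero]
    rfl
  · intro x
    induction x using DirectSum.induction_on with
    | zero => exact ⟨0, map_zero Θ⟩
    | of k f =>
      obtain ⟨P, hP⟩ := exists_eval_generators f.2
      refine ⟨P, coeAlgHom_symForms_injective (funext fun τ => ?_)⟩
      rw [key, DirectSum.coeAlgHom_of, hP]
    | add x y hx hy =>
      obtain ⟨P, rfl⟩ := hx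
      obtain ⟨Q, rfl⟩ := hy
      exact ⟨P + Q, map_add Θ P Q⟩
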